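/- Let $(R,\mathfrak m)$ be a complete Noetherian local ring that is Gorenstein, i.e. $R$ has finite injective dimension as a module over itself. A system of parameters of $R$ is a sequence $x_1,\dots,x_d$, $d=\dim R$, such that $\sqrt{(x_1,\dots,x_d)}=\mathfrak m$. (0) A closure operation $\mathrm{cl}$ on finitely generated $R$-modules assigns to each submodule $L$ of a finitely generated $R$-module $M$ a submodule $L\subseteq L^{\mathrm{cl}}_M\subseteq M$, such that $(L^{\mathrm{cl}}_M)^{\mathrm{cl}}_M=L^{\mathrm{cl}}_M$, and $L^{\mathrm{cl}}_M\subseteq N^{\mathrm{cl}}_M$ whenever $L\subseteq N\subseteq M$. It is functorial if $g(L^{\mathrm{cl}}_M)\subseteq g(L)^{\mathrm{cl}}_N$ for all $R$-linear $g:M\to N$, and residual if $(\ker q)^{\mathrm{cl}}_M=q^{-1}(0^{\mathrm{cl}}_P)$ for all surjective $R$-linear $q:M\to P$. Let $\mathrm{cl}$ be a functorial and residual closure operation. If there is a system of parameters $x_1,\dots,x_d$ of $R$ such that the ideal $(x_1^t,\dots,x_d^t)$ is $\mathrm{cl}$-closed in $R$ for infinitely many $t\in\mathbb N$, then $I^{\mathrm{cl}}_R=I$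 for every ideal $I$ of $R$, and $0^{\mathrm{cl}}_M=0$ for every finitely generated $R$-module $M$. (1) If $R$ is equicharacteristic and $F$-rational, then it is $F$-regular. Explicitly: (1a) Let $R$ have prime characteristic $p$. For an ideal $I$ of a Noetherian ring $S$ of characteristic $p$, the tight closure $I^*$ is the set of all $u\in S$ for which there is $c\in S$ outside every minimal prime of $S$ with $cu^{q}\in I^{[q]}=(a^q: a\in I)$ for all sufficiently large powers $q$ of $p$. If every ideal of $R$ generated by a system of parameters is tightly closed ($R$ is $F$-rational), then every ideal of $R$ and of each localization $R_P$, $P\in\operatorname{Spec}R$, is tightly closed ($R$ is $F$-regular). (1b) Let $K$ be a field of characteristic $0$ and let $R$ be a $K$-algebra. For an ideal $I$ of a $K$-algebra $C$, let $I^{>*K}$ be the set of all $w\in C$ for which there are a finitely generated subring $A\subseteq K$, an $A$-algebra $D$ of finite type, an $A$-algebra homomorphism $\varphi:D\to C$, an ideal $J\subseteq D$ and $t\in D$ with $JC=I$ and $\varphi(t)=w$, and some $0\neq a\in A$ such that for all maximal ideals $\mu\not\ni a$ of $A$, the image of $t$ in $D/\mu D$ lies in the (characteristic $p=\operatorname{char}A/\mu$)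 tight closure of $J(D/\mu D)$. The tight closure of an ideal $I$ of $R$ is the set of all $w\in R$ whose image in $R/P$ lies in $(I(R/P))^{>*K}$ for every minimal prime $P$ of $R$ (the $K$-tight closure of Hochster and Huneke; equational tight closure if $K=\mathbb Q$). If every ideal of $R$ generated by a system of parameters is tightly closed in this sense ($R$ is $F$-rational), then every ideal of $R$ is tightly closed in this sense ($R$ is $F$-regular). (2) Let $R$ have prime characteristic $p$ and be $F$-injective, i.e. the Frobenius map $R\to F_*R$ (where $F_*R$ is $R$ as an $R$-module via $a\mapsto a^p$) induces injective maps $H^i_{\mathfrak m}(R)\to H^i_{\mathfrak m}(F_*R)$ for all $i\ge 0$. Then $R$ is $F$-pure, i.e. $M\otimes_R R\to M\otimes_R F_*R$ is injective for every $R$-module $M$. -/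

import Mathlib

open CategoryTheory TensorProduct

universe u v

namespace FSing

/-! ### Gorenstein rings and systems of parameters -/

/-- A local ring is Gorenstein if it has finite injective dimension as a module over itself.
(Used for Noetherian local rings.) -/
def IsGorensteinLocal (R : Type u) [CommRing R] [IsLocalRing R] : Prop :=
  ∃ n : ℕ, HasInjectiveDimensionLE (ModuleCat.of.{u} R R) n

/-- A system of parameters of a local ring: `d = dim R` elements generating an ideal whose
radical is the maximal ideal. -/
def IsSystemOfParameters (R : Type u) [CommRing R] [IsLocalRing R] {d : ℕ} (x : Fin d → R) :
    Prop :=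
  ringKrullDim R = d ∧ (Ideal.span (Set.range x)).radical = IsLocalRing.maximalIdeal R

/-! ### Closure operations on finitely generated modules -/

/-- A closure operation on submodules of finitely generated `R`-modules. -/
structure ClosureOperation (R : Type u) [CommRing R] where
  /-- The closure of the submodule `L` in the ambient module `M`. -/
  cl : ∀ (M : Type u) [AddCommGroup M] [Module R M] [Module.Finite R M],
    Submodule R M → Submodule R M
  le_cl : ∀ (M : Type u) [AddCommGroup M] [Module R M] [Module.Finite R M]
    (L : Submodule R M), L ≤ cl M L
  cl_cl : ∀ (M : Type u) [AddCommGroup M] [Module R M] [Module.Finite R M]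
    (L : Submodule R M), cl M (cl M L) = cl M L
  cl_mono : ∀ (M : Type u) [AddCommGroup M] [Module R M] [Module.Finite R M]
    (L N : Submodule R M), L ≤ N → cl M L ≤ cl M N

/-- `g(L^cl_M) ⊆ g(L)^cl_N` for every linear map `g : M → N`. -/
def ClosureOperation.Functorial {R : Type u} [CommRing R] (c : ClosureOperation R) : Prop :=
  ∀ (M N : Type u) [AddCommGroup M] [Module R M] [Module.Finite R M]
    [AddCommGroup N] [Module R N] [Module.Finite R N] (g : M →ₗ[R] N) (L : Submodule R M),
    (c.cl M L).map g ≤ c.cl N (L.map g)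

/-- `(ker q)^cl_M = q⁻¹(0^cl_P)` for every surjective linear map `q : M → P`. -/
def ClosureOperation.Residual {R : Type u} [CommRing R] (c : ClosureOperation R) : Prop :=
  ∀ (M P : Type u) [AddCommGroup M] [Module R M] [Module.Finite R M]
    [AddCommGroup P] [Module R P] [Module.Finite R P] (q : M →ₗ[R] P),
    Function.Surjective q → c.cl M (LinearMap.ker q) = (c.cl P ⊥).comap q

/-! ### Tight closure in prime characteristic -/

/-- The bracket power `I^[q]`, generated by the `q`-th powers of the elements of `I`. -/
def bracketPower {S : Type*} [CommRing S] (I : Ideal S) (q : ℕ) : Ideal S :=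
  Ideal.span ((fun a => a ^ q) '' (I : Set S))

/-- The tight closure of an ideal in a Noetherian ring `S` of prime characteristic `p`:
`u ∈ I^*` iff there is `c` outside all minimal primes of `S` with `c u^q ∈ I^[q]` for all
large powers `q` of `p`. -/
def tightClosure (p : ℕ) {S : Type*} [CommRing S] (I : Ideal S) : Set S :=
  {u | ∃ c : S, (∀ P ∈ minimalPrimes S, c ∉ P) ∧
    ∃ e₀ : ℕ, ∀ e : ℕ, e₀ ≤ e → c * u ^ p ^ e ∈ bracketPower I (p ^ e)}

/-- A local ring of characteristic `p` is `F`-rational if every ideal generated by a system of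
parameters is tightly closed. -/
def IsFRational (p : ℕ) (R : Type u) [CommRing R] [IsLocalRing R] : Prop :=
  ∀ (d : ℕ) (x : Fin d → R), IsSystemOfParameters R x →
    tightClosure p (Ideal.span (Set.range x)) = (Ideal.span (Set.range x) : Set R)

/-- A ring of characteristic `p` is `F`-regular if every ideal of it and of all its
localizations at primes is tightly closed. -/
def IsFRegular (p : ℕ) (R : Type u) [CommRing R] : Prop :=
  (∀ I : Ideal R, tightClosure p I = (I : Set R)) ∧
  ∀ (P : Ideal R) [P.IsPrime] (I : Ideal (Localization.AtPrime P)),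
    tightClosure p I = (I : Set (Localization.AtPrime P))

/-! ### Tight closure in equal characteristic zero -/

/-- The direct `K`-tight closure of an ideal `I` in an algebra `C` over a field `K` of
characteristic zero: `w` is in it if the pair `(I, w)` is the image of a pair `(J, t)` in an algebra
`D` of finite type over a finitely generated subring `A` of `K`, such that on the fibre `D/μD`
over each closed point `μ` of a nonempty open subset `{a ≠ 0}` of `Spec A`, `t` is in
the (characteristic `p`) tight closure of `J`. Here `p` is the characteristic of `A/μ`. -/
def directTightClosure (K : Type v) [Field K] {C : Type u} [CommRing C] [Algebra K C]
    (I : Ideal C) : Set C :=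
  {w | ∃ (A : Subalgebra ℤ K) (_ : A.FG) (D : Type) (_ : CommRing D) (_ : Algebra A D)
    (_ : Algebra.FiniteType A D) (φ : D →ₐ[A] C) (J : Ideal D) (t : D),
    J.map φ = I ∧ φ t = w ∧
    ∃ a : A, a ≠ 0 ∧ ∀ μ : Ideal A, μ.IsMaximal → a ∉ μ →
      ∀ p : ℕ, p.Prime → (p : A) ∈ μ →
        Ideal.Quotient.mk (μ.map (algebraMap A D)) t ∈
          tightClosure p (J.map (Ideal.Quotient.mk (μ.map (algebraMap A D))))}

/-- The `K`-tight closure of an ideal `I` of a complete Noetherian local `K`-algebra `R`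
(`K` a field of characteristic zero): the elements whose image in every complete local domain `R/P`,
`P` a minimal prime, is in the direct `K`-tight closure of the image of `I`.
For `K = ℚ` this is equational tight closure. -/
def zeroTightClosure (K : Type v) [Field K] {R : Type u} [CommRing R] [Algebra K R]
    (I : Ideal R) : Set R :=
  {w | ∀ P ∈ minimalPrimes R,
    Ideal.Quotient.mk P w ∈ directTightClosure K (I.map (Ideal.Quotient.mk P))}

/-- `F`-rationality of a complete local ring over a field `K` of characteristic zero: every ideal
generated by a system of parameters is tightly closed. -/
def IsFRationalZero (K : Type v) [Field K] (R : Type u) [CommRing R] [IsLocalRing R]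
    [Algebra K R] : Prop :=
  ∀ (d : ℕ) (x : Fin d → R), IsSystemOfParameters R x →
    zeroTightClosure K (Ideal.span (Set.range x)) = (Ideal.span (Set.range x) : Set R)

/-- `F`-regularity of a complete local ring over a field `K` of characteristic zero: every ideal is
tightly closed. -/
def IsFRegularZero (K : Type v) [Field K] (R : Type u) [CommRing R] [Algebra K R] : Prop :=
  ∀ I : Ideal R, zeroTightClosure K I = (I : Set R)

/-! ### `F`-injectivity and `F`-purity -/

/-- `F_*R`: the ring `R` regarded as an `R`-module by restriction of scalars along Frobenius. -/
def FrobeniusPushforward (_p : ℕ) (R : Type u) : Type u := R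

instance (p : ℕ) (R : Type u) [CommRing R] : AddCommGroup (FrobeniusPushforward p R) :=
  inferInstanceAs (AddCommGroup R)

instance (p : ℕ) [Fact p.Prime] (R : Type u) [CommRing R] [CharP R p] :
    Module R (FrobeniusPushforward p R) :=
  Module.compHom R (frobenius R p)

/-- The Frobenius as an `R`-linear map `R → F_*R`, `a ↦ a ^ p`. -/
def frobeniusLinear (p : ℕ) [Fact p.Prime] (R : Type u) [CommRing R] [CharP R p] :
    R →ₗ[R] FrobeniusPushforward p R where
  toFun := frobenius R p
  map_add' := map_add (frobenius R p)
  map_smul' := map_mul (frobenius R p)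

/-- `R` is `F`-injective if Frobenius induces an injective map
`H^i_𝔪(R) → H^i_𝔪(F_*R) = F_*H^i_𝔪(R)` for every `i`. -/
def IsFInjective (p : ℕ) [Fact p.Prime] (R : Type u) [CommRing R] [IsLocalRing R]
    [CharP R p] : Prop :=
  ∀ i : ℕ, Function.Injective
    ((localCohomology (IsLocalRing.maximalIdeal R) i).map
      (ModuleCat.ofHom (frobeniusLinear p R))).hom

/-- `R` is `F`-pure if Frobenius `R → F_*R` is pure, i.e. stays injective after tensoring
with any module. -/
def IsFPure (p : ℕ) [Fact p.Prime] (R : Type u) [CommRing R] [CharP R p] : Prop :=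
  ∀ (M : Type u) [AddCommGroup M] [Module R M],
    Function.Injective (LinearMap.lTensor M (frobeniusLinear p R))

end FSing

/-!
Let `x` be a system of parameters of the Gorenstein local ring `R`; it is a regular sequence of
length `d = dim R`, and `Ext^{d+1}(-, R) = 0` on finite modules. Rees's isomorphism
`Hom(N, R/(x)) ≅ Ext^d(N, R)`, for `N` killed by `x`, turns this vanishing into the self-injectivity
of `R/(x)`. Applied to the `R/(x^t)`, self-injectivity and Krull's intersection theorem show that
every nonzero element of a finite module has nonzero image under some linear map to some `R/(x^t)`,
where `t` may be taken from any given infinite set. So a functorial closure operation that fixes the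
ideals `(x^t)` fixes everything, and tight closure behaves functorially along maps of cyclic modules
in both characteristics.

To pass to a localization `R_P`, choose a regular sequence with `P` minimal over it. Its powers
generate unmixed ideals, so a single element outside `P` clears the denominators of all Frobenius
powers at once, and tight closure of these ideals commutes with localization at `P`.

Finally, by Rees's isomorphism again, the ideal `(x)` is the annihilator of a class in
`H^d_𝔪(R)`; the class survives in the direct limit because the transition maps are injective.
If Frobenius is injective on local cohomology, it follows that the ideals `(x^t)` are Frobenius
closed, and since the `R/(x^t)` detect nonzero elements, Frobenius is pure.
-/

namespace FSing

open Abelian RingTheory.Sequence IsLocalRing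

/-! ### Ext modules and regular sequences -/

section ExtOfRegular

variable {R : Type u} [CommRing R]

theorem smul_ext_eq_zero {N M : ModuleCat.{u} R} {r : R} (hr : ∀ n : N, r • n = 0) {i : ℕ}
    (x : Ext N M i) : r • x = 0 := by
  rw [Ext.smul_eq_comp_mk₀]
  exact congrArg (fun f => f.hom x)
    (Ext.postcomp_smul_id_eq_zero_of_mem_annihilator (Module.mem_annihilator.2 hr) i)

/-- The class in `Ext¹ (M ⧸ r M) M` of `0 → M → M → M ⧸ r M → 0`, for `r` regular on `M`. -/
noncomputable def quotSMulTopExtClass (M : ModuleCat.{u} R) {r : R} (reg : IsSMulRegular M r) :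
    Ext (ModuleCat.of R (QuotSMulTop r M)) M 1 :=
  reg.smulShortComplex_shortExact.extClass

theorem exists_comp_quotSMulTopExtClass_eq {M N : ModuleCat.{u} R} {r : R}
    (reg : IsSMulRegular M r) {i : ℕ} (x : Ext N M (i + 1)) (hx : r • x = 0) :
    ∃ y : Ext N (ModuleCat.of R (QuotSMulTop r M)) i,
      y.comp (quotSMulTopExtClass M reg) rfl = x := by
  rw [Ext.smul_eq_comp_mk₀] at hx
  exact Ext.covariant_sequence_exact₁ N reg.smulShortComplex_shortExact x hx rfl

theorem comp_quotSMulTopExtClass_bijective {M N : ModuleCat.{u} R} {r : R}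
    (reg : IsSMulRegular M r) (hr : ∀ n : N, r • n = 0) (i : ℕ) [Subsingleton (Ext N M i)] :
    Function.Bijective (fun y : Ext N (ModuleCat.of R (QuotSMulTop r M)) i =>
      y.comp (quotSMulTopExtClass M reg) rfl) := by
  refine ⟨(injective_iff_map_eq_zero ((Ext.postcomp (quotSMulTopExtClass M reg) N rfl))).2
    fun y hy => ?_, fun x => exists_comp_quotSMulTopExtClass_eq reg x (smul_ext_eq_zero hr x)⟩
  obtain ⟨x, rfl⟩ := Ext.covariant_sequence_exact₃ N reg.smulShortComplex_shortExact y rfl hy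
  exact (congrArg (Ext.comp · _ _) (Subsingleton.elim (α := Ext N M i) x 0)).trans
    (Ext.zero_comp ..)

theorem subsingleton_ext_quotSMulTop {M N : ModuleCat.{u} R} {r : R} (reg : IsSMulRegular M r)
    {i : ℕ} [Subsingleton (Ext N M i)] [Subsingleton (Ext N M (i + 1))] :
    Subsingleton (Ext N (ModuleCat.of R (QuotSMulTop r M)) i) := by
  refine subsingleton_of_forall_eq 0 fun y => ?_
  obtain ⟨x, rfl⟩ := Ext.covariant_sequence_exact₃ N reg.smulShortComplex_shortExact y rfl
    (Subsingleton.elim (α := Ext N M (i + 1)) _ _)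
  exact (congrArg (Ext.comp · _ _) (Subsingleton.elim (α := Ext N M i) x 0)).trans
    (Ext.zero_comp ..)

theorem subsingleton_ext_of_isWeaklyRegular {M N : ModuleCat.{u} R} {rs : List R}
    (reg : IsWeaklyRegular M rs) (hN : ∀ r ∈ rs, ∀ n : N, r • n = 0) {i : ℕ}
    (hi : i < rs.length) : Subsingleton (Ext N M i) := by
  induction rs generalizing M i with
  | nil => exact absurd hi (Nat.not_lt_zero i)
  | cons r rs ih =>
    rw [isWeaklyRegular_cons_iff] at reg
    rw [List.forall_mem_cons] at hN
    match i with
    | 0 =>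
      have : Subsingleton (N →ₗ[R] M) :=
        reg.1.linearMap_subsingleton_of_mem_annihilator (Module.mem_annihilator.2 hN.1)
      exact (Ext.homEquiv₀.trans ModuleCat.homEquiv).subsingleton
    | i + 1 =>
      refine subsingleton_of_forall_eq 0 fun x => ?_
      obtain ⟨y, rfl⟩ := exists_comp_quotSMulTopExtClass_eq reg.1 x (smul_ext_eq_zero hN.1 x)
      have : Subsingleton (Ext N (ModuleCat.of R (QuotSMulTop r M)) i) :=
        ih reg.2 hN.2 (Nat.lt_of_succ_lt_succ hi)
      rw [Subsingleton.elim y 0, Ext.zero_comp]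

/-- Rees's isomorphism `Hom (N, M ⧸ rs M) ≅ Ext^|rs| (N, M)`, induced by a class that does not
depend on `N`. -/
theorem exists_ext_comp_bijective (M : ModuleCat.{u} R) (rs : List R)
    (reg : IsWeaklyRegular M rs) :
    ∃ η : Ext (ModuleCat.of R (M ⧸ Ideal.ofList rs • (⊤ : Submodule R M))) M rs.length,
      ∀ N : ModuleCat.{u} R, (∀ r ∈ rs, ∀ n : N, r • n = 0) →
        Function.Bijective
          (fun φ : N ⟶ ModuleCat.of R (M ⧸ Ideal.ofList rs • (⊤ : Submodule R M)) =>
            (Ext.mk₀ φ).comp η (zero_add _)) := by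
  induction rs generalizing M with
  | nil =>
    let e : ModuleCat.of R (M ⧸ Ideal.ofList ([] : List R) • (⊤ : Submodule R M)) ≅ M :=
      (Submodule.quotEquivOfEqBot _ (by simp)).toModuleIso
    refine ⟨Ext.mk₀ e.hom, fun N _ => ?_⟩
    change Function.Bijective (fun φ : N ⟶ _ => (Ext.mk₀ φ).comp (Ext.mk₀ e.hom) (zero_add 0))
    simp only [Ext.mk₀_comp_mk₀]
    exact (Ext.mk₀_bijective N M).comp e.homToEquiv.bijective
  | cons r rs ih =>
    have ⟨reg_r, reg_rs⟩ := (isWeaklyRegular_cons_iff M r rs).1 reg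
    obtain ⟨η, hη⟩ := ih (ModuleCat.of R (QuotSMulTop r M)) reg_rs
    let δ := quotSMulTopExtClass M reg_r
    let e : ModuleCat.of R (M ⧸ Ideal.ofList (r :: rs) • (⊤ : Submodule R M)) ≅
        ModuleCat.of R (QuotSMulTop r M ⧸ Ideal.ofList rs • (⊤ : Submodule R (QuotSMulTop r M))) :=
      (Submodule.quotOfListConsSMulTopEquivQuotSMulTopInner M r rs).toModuleIso
    refine ⟨(Ext.mk₀ e.hom).comp (η.comp δ rfl) (zero_add _), fun N hN => ?_⟩
    have := subsingleton_ext_of_isWeaklyRegular reg hN (Nat.lt_succ_self rs.length)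
    rw [List.forall_mem_cons] at hN
    have factor (φ : N ⟶ ModuleCat.of R (M ⧸ Ideal.ofList (r :: rs) • (⊤ : Submodule R M))) :
        (Ext.mk₀ φ).comp ((Ext.mk₀ e.hom).comp (η.comp δ rfl) (zero_add _)) (zero_add _) =
          ((Ext.mk₀ (φ ≫ e.hom)).comp η (zero_add _)).comp δ rfl := by
      rw [← Ext.comp_assoc _ _ _ (zero_add 0) (zero_add _) (by simp), Ext.mk₀_comp_mk₀,
        ← Ext.comp_assoc _ _ _ (zero_add _) rfl (by simp)]
    rw [funext factor]
    exact (comp_quotSMulTopExtClass_bijective reg_r hN.1 rs.length).comp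
      ((hη N hN.2).comp e.homToEquiv.bijective)

end ExtOfRegular

section LocalVanishing

variable {R : Type u} [CommRing R]

/-- `Ext i N M = 0` for all finite modules `N` and all `i ≥ n`. For finite modules over a
Noetherian ring this is the statement that the injective dimension of `M` is less than `n`, in a
form that only refers to finite modules. -/
def ExtVanishing (M : ModuleCat.{u} R) (n : ℕ) : Prop :=
  ∀ N : ModuleCat.{u} R, Module.Finite R N → ∀ i, n ≤ i → Subsingleton (Ext N M i)

theorem subsingleton_ext_of_iso {N N' M : ModuleCat.{u} R} (e : N ≅ N') {n : ℕ}
    [Subsingleton (Ext N' M n)] : Subsingleton (Ext N M n) := by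
  refine subsingleton_of_forall_eq 0 fun x => ?_
  rw [← Ext.mk₀_id_comp x, ← e.hom_inv_id, ← Ext.mk₀_comp_mk₀,
    Ext.comp_assoc _ _ _ (zero_add 0) (zero_add _) (by simp),
    Subsingleton.elim ((Ext.mk₀ e.inv).comp x (zero_add n)) 0, Ext.comp_zero]

theorem subsingleton_ext_of_shortExact {S : ShortComplex (ModuleCat.{u} R)} (hS : S.ShortExact)
    {M : ModuleCat.{u} R} {n : ℕ} (h₁ : Subsingleton (Ext S.X₁ M n))
    (h₃ : Subsingleton (Ext S.X₃ M n)) : Subsingleton (Ext S.X₂ M n) := by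
  refine subsingleton_of_forall_eq 0 fun x => ?_
  obtain ⟨y, rfl⟩ := Ext.contravariant_sequence_exact₂ hS M x (h₁.elim _ _)
  rw [h₃.elim y 0, Ext.comp_zero]

theorem subsingleton_ext_left_of_shortExact {S : ShortComplex (ModuleCat.{u} R)}
    (hS : S.ShortExact) {M : ModuleCat.{u} R} {n : ℕ} (h₂ : Subsingleton (Ext S.X₂ M n))
    (h₃ : Subsingleton (Ext S.X₃ M (n + 1))) : Subsingleton (Ext S.X₁ M n) := by
  refine subsingleton_of_forall_eq 0 fun x => ?_
  obtain ⟨y, rfl⟩ := Ext.contravariant_sequence_exact₁ hS M x (add_comm 1 n) (h₃.elim _ _)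
  rw [h₂.elim y 0, Ext.comp_zero]

theorem subsingleton_ext_quotient_ofList {rs : List R} [IsLocalRing R] [IsNoetherianRing R]
    (reg : IsRegular R rs) (M : ModuleCat.{u} R) {i : ℕ} (hi : rs.length < i) :
    Subsingleton (Ext (ModuleCat.of R (R ⧸ Ideal.ofList rs)) M i) := by
  have projDim := ModuleCat.projectiveDimension_quotient_eq_length.{u} rs reg
  rw [projectiveDimension_eq_of_iso (Shrink.linearEquiv R (R ⧸ Ideal.ofList rs)).toModuleIso]
    at projDim
  have : HasProjectiveDimensionLT (ModuleCat.of R (R ⧸ Ideal.ofList rs)) i := by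
    rw [← projectiveDimension_lt_iff, projDim]
    exact_mod_cast hi
  exact HasProjectiveDimensionLT.subsingleton _ i i le_rfl M

theorem ofList_ne_top_of_isRegular {rs : List R} (reg : IsRegular R rs) :
    Ideal.ofList rs ≠ ⊤ :=
  fun h => reg.top_ne_smul (by rw [h, Submodule.top_smul])

theorem smul_quotient_eq_zero {I : Ideal R} {r : R} (hr : r ∈ I) (a : R ⧸ I) : r • a = 0 := by
  rw [← Ideal.annihilator_quotient (I := I)] at hr
  exact Module.mem_annihilator.1 hr a

theorem isAssociatedPrime_of_mem_minimalPrimes [IsNoetherianRing R] {I P : Ideal R}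
    (hP : P ∈ I.minimalPrimes) :
    IsAssociatedPrime P (R ⧸ I) := by
  have := Module.associatedPrimes.minimalPrimes_annihilator_subset_associatedPrimes R (R ⧸ I)
  rw [Ideal.annihilator_quotient] at this
  exact this hP

/-- The two ways of writing `R` modulo the ideal of `rs`: Mathlib's theory of regular sequences
on a module `M` uses `M ⧸ (rs) • ⊤`. -/
def quotientOfListEquiv (rs : List R) :
    (R ⧸ Ideal.ofList rs) ≃ₗ[R] (R ⧸ Ideal.ofList rs • (⊤ : Submodule R R)) :=
  Submodule.quotEquivOfEq _ _ (by simp)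

variable [IsLocalRing R] [IsNoetherianRing R] {M : ModuleCat.{u} R}

open scoped Pointwise in
/-- If `x ∈ 𝔪` is outside `P`, then multiplication by `x` on `Extⁿ (R ⧸ P, M)` is onto, because its
cokernel embeds into `Extⁿ⁺¹ (R ⧸ (P, x), M)`; now apply Nakayama's lemma. -/
theorem ExtVanishing.subsingleton_ext_quotient_prime [Module.Finite R M] {n : ℕ}
    (hM : ExtVanishing M (n + 1)) (P : Ideal R) [P.IsPrime] (hP : P ≠ maximalIdeal R) :
    Subsingleton (Ext (ModuleCat.of R (R ⧸ P)) M n) := by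
  obtain ⟨x, x_mem, x_notMem⟩ : ∃ x ∈ maximalIdeal R, x ∉ P :=
    SetLike.exists_of_lt (lt_of_le_of_ne (le_maximalIdeal Ideal.IsPrime.ne_top') hP)
  have reg : IsSMulRegular (ModuleCat.of R (R ⧸ P)) x :=
    (isSMulRegular_quotient_iff_mem_of_smul_mem P x).2 fun a ha =>
      (Ideal.IsPrime.mem_or_mem ‹_› ha).resolve_left x_notMem
  by_contra! nontrivial_ext
  have x_mem_jacobson : x ∈ (Module.annihilator R (Ext (ModuleCat.of R (R ⧸ P)) M n)).jacobson :=
    maximalIdeal_le_jacobson _ x_mem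
  refine Submodule.top_ne_pointwise_smul_of_mem_jacobson_annihilator x_mem_jacobson
    (le_antisymm (fun y _ => ?_) le_top)
  have : Subsingleton (Ext (ModuleCat.of R (QuotSMulTop x (R ⧸ P))) M (n + 1)) :=
    hM _ (inferInstanceAs (Module.Finite R (QuotSMulTop x (R ⧸ P)))) _ le_rfl
  obtain ⟨z, rfl⟩ := Ext.contravariant_sequence_exact₁ reg.smulShortComplex_shortExact M y
    (add_comm 1 n) (this.elim _ _)
  have mul_x (z : Ext (ModuleCat.of R (R ⧸ P)) M n) :
      (Ext.mk₀ (x • 𝟙 (ModuleCat.of R (R ⧸ P)))).comp z (zero_add n) = x • z := by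
    simp [Ext.mk₀_smul]
  exact Set.mem_of_eq_of_mem (mul_x z)
    (Submodule.smul_mem_pointwise_smul (M := Ext (ModuleCat.of R (R ⧸ P)) M n) z x ⊤ trivial)

theorem ExtVanishing.of_residueField [Module.Finite R M] {n : ℕ} (hM : ExtVanishing M (n + 1))
    (hk : Subsingleton (Ext (ModuleCat.of R (R ⧸ maximalIdeal R)) M n)) :
    ExtVanishing M n := by
  intro N hN i hi
  obtain rfl | hi := hi.eq_or_lt
  · refine IsNoetherianRing.induction_on_isQuotientEquivQuotientPrime R hN
      (motive := fun N _ _ _ => Subsingleton (Ext (ModuleCat.of R N) M n)) ?zero ?prime ?shortExact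
    case zero =>
      intro N _ _ _ _
      refine subsingleton_of_forall_eq 0 fun x => ?_
      have id_eq_zero : 𝟙 (ModuleCat.of R N) = 0 := by
        ext a
        exact Subsingleton.elim _ _
      rw [← Ext.mk₀_id_comp x, id_eq_zero, Ext.mk₀_zero, Ext.zero_comp]
    case prime =>
      intro N _ _ _ p e
      have : Subsingleton (Ext (ModuleCat.of R (R ⧸ p.asIdeal)) M n) := by
        by_cases hp : p.asIdeal = maximalIdeal R
        · rwa [hp]
        · exact hM.subsingleton_ext_quotient_prime p.asIdeal hp
      exact subsingleton_ext_of_iso e.toModuleIso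
    case shortExact =>
      intro N₁ _ _ _ N₂ _ _ _ N₃ _ _ _ f g hf hg hfg h₁ h₃
      let S : ShortComplex (ModuleCat.{u} R) :=
        ModuleCat.shortComplexOfCompEqZero f g hfg.linearMap_comp_eq_zero
      exact subsingleton_ext_of_shortExact (S := S) (ModuleCat.shortComplex_shortExact S hfg hf hg)
        h₁ h₃
  · exact hM N hN i hi

/-- The residue field embeds into `R ⧸ rs`, which has projective dimension `|rs|`; so above degree
`|rs|`, vanishing in degree `k + 1` forces vanishing of `Extᵏ` of the residue field. -/
theorem ExtVanishing.of_isAssociatedPrime_quotient [Module.Finite R M] {n : ℕ}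
    (hM : ExtVanishing M n) {rs : List R} (reg : IsRegular R rs)
    (assoc : IsAssociatedPrime (maximalIdeal R) (R ⧸ Ideal.ofList rs)) :
    ExtVanishing M (rs.length + 1) := by
  obtain ⟨f, hf⟩ := ((isAssociatedPrime_iff_exists_injective_linearMap _ _).1 assoc).2
  have descend {k : ℕ} (hk : rs.length < k) (hMk : ExtVanishing M (k + 1)) : ExtVanishing M k := by
    let S : ShortComplex (ModuleCat.{u} R) :=
      ModuleCat.shortComplexOfCompEqZero f (LinearMap.range f).mkQ (LinearMap.range_mkQ_comp f)
    have hS : S.ShortExact := ModuleCat.shortComplex_shortExact S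
      f.exact_map_mkQ_range hf (Submodule.mkQ_surjective _)
    refine hMk.of_residueField (subsingleton_ext_left_of_shortExact hS
      (subsingleton_ext_quotient_ofList reg M hk) (hMk S.X₃ ?_ _ le_rfl))
    exact inferInstanceAs (Module.Finite R (_ ⧸ LinearMap.range f))
  obtain hn | hn := le_total n (rs.length + 1)
  · exact fun N hN i hi => hM N hN i (hn.trans hi)
  · exact Nat.decreasingInduction' (fun k _ hk hMk => descend hk hMk) hn hM

theorem eq_maximalIdeal_of_isAssociatedPrime_quotient_ofList {rs : List R} (reg : IsRegular R rs)
    (hR : ExtVanishing (ModuleCat.of R R) (rs.length + 1)) {P : Ideal R}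
    (assoc : IsAssociatedPrime P (R ⧸ Ideal.ofList rs)) : P = maximalIdeal R := by
  by_contra hP
  have : P.IsPrime := assoc.isPrime
  obtain ⟨f, hf⟩ := ((isAssociatedPrime_iff_exists_injective_linearMap _ _).1 assoc).2
  obtain ⟨η, hη⟩ := exists_ext_comp_bijective (ModuleCat.of R R) rs reg.1
  have rs_smul_eq_zero : ∀ r ∈ rs, ∀ a : R ⧸ P, r • a = 0 := fun r hr a => hf <| by
    rw [map_smul, map_zero]
    exact smul_quotient_eq_zero (I := Ideal.ofList rs) (Ideal.subset_span hr) (f a)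
  have : Subsingleton (Ext (ModuleCat.of R (R ⧸ P)) (ModuleCat.of R R) rs.length) :=
    hR.subsingleton_ext_quotient_prime P hP
  let e := quotientOfListEquiv rs
  have comp_eq_zero : ModuleCat.ofHom (e.toLinearMap ∘ₗ f) = 0 :=
    (hη (ModuleCat.of R (R ⧸ P)) rs_smul_eq_zero).1 (Subsingleton.elim _ _)
  have f_one : e (f 1) = 0 := congrArg (fun g => g.hom (1 : R ⧸ P)) comp_eq_zero
  exact one_ne_zero (hf ((e.map_eq_zero_iff.1 f_one).trans f.map_zero.symm))

theorem radical_ofList_eq_maximalIdeal {rs : List R} (reg : IsRegular R rs)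
    (hR : ExtVanishing (ModuleCat.of R R) (rs.length + 1)) :
    (Ideal.ofList rs).radical = maximalIdeal R := by
  refine le_antisymm (Ideal.IsPrime.radical_le_iff inferInstance |>.2
    (le_maximalIdeal (ofList_ne_top_of_isRegular reg))) ?_
  rw [← Ideal.sInf_minimalPrimes]
  exact le_sInf fun P hP => (eq_maximalIdeal_of_isAssociatedPrime_quotient_ofList reg hR
    (isAssociatedPrime_of_mem_minimalPrimes hP)).ge

end LocalVanishing

/-! ### Depth and dimension -/

section Depth

variable {R : Type u} [CommRing R]

theorem support_quotSMulTop_inter_zeroLocus {M : Type u} [AddCommGroup M] [Module R M]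
    [Module.Finite R M] (x : R) (xs : List R) :
    Module.support R (QuotSMulTop x M) ∩ PrimeSpectrum.zeroLocus {r | r ∈ xs} =
      Module.support R M ∩ PrimeSpectrum.zeroLocus {r | r ∈ x :: xs} := by
  rw [Module.support_quotSMulTop, Set.inter_assoc, ← PrimeSpectrum.zeroLocus_union,
    Set.singleton_union]
  simp only [Set.insert_def, Set.mem_ofPred_eq, List.mem_cons]

section LocalRing

variable [IsLocalRing R]

theorem support_quotient_maximalIdeal :
    Module.support R (R ⧸ maximalIdeal R) = PrimeSpectrum.zeroLocus (maximalIdeal R) := by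
  rw [Module.support_eq_zeroLocus, Ideal.annihilator_quotient]

theorem maximalIdeal_smul_top_lt_top (M : Type u) [AddCommGroup M] [Module R M]
    [Module.Finite R M] [Nontrivial M] : maximalIdeal R • (⊤ : Submodule R M) < ⊤ := by
  refine lt_top_iff_ne_top.2 fun h => top_ne_bot (α := Submodule R M) ?_
  exact Module.Finite.fg_top.eq_bot_of_le_jacobson_smul (by rw [ringJacobson_eq_maximalIdeal, h])

end LocalRing

variable [IsNoetherianRing R]

theorem isSMulRegular_iff_forall_notMem_associatedPrimes {M : Type u} [AddCommGroup M]
    [Module R M] {x : R} : IsSMulRegular M x ↔ ∀ P ∈ associatedPrimes R M, x ∉ P := by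
  have := (Set.ext_iff.1 (biUnion_associatedPrimes_eq_compl_regular R M) x).not
  simpa only [Set.mem_compl_iff, Set.mem_ofPred_eq, not_not, Set.mem_iUnion, SetLike.mem_coe,
    not_exists] using this.symm

theorem exists_mem_isSMulRegular_or_exists_isAssociatedPrime (J : Ideal R) (M : Type u)
    [AddCommGroup M] [Module R M] [Module.Finite R M] :
    (∃ x ∈ J, IsSMulRegular M x) ∨ ∃ Q, IsAssociatedPrime Q M ∧ J ≤ Q := by
  by_cases h : Subsingleton ((R ⧸ J) →ₗ[R] M)
  · obtain ⟨x, hx, reg⟩ := IsSMulRegular.subsingleton_linearMap_iff.1 h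
    exact Or.inl ⟨x, Ideal.annihilator_quotient.le hx, reg⟩
  · have := not_subsingleton_iff_nontrivial.1 h
    obtain ⟨f, hf⟩ := exists_ne (0 : (R ⧸ J) →ₗ[R] M)
    have f_one : f 1 ≠ 0 := fun h => hf (by ext; simpa using h)
    obtain ⟨Q, hQ, le⟩ := exists_le_isAssociatedPrime_of_isNoetherianRing R (f 1) f_one
    refine Or.inr ⟨Q, hQ, fun a ha => le ?_⟩
    rw [Submodule.mem_colon_singleton, Submodule.mem_bot, ← map_smul, smul_quotient_eq_zero ha,
      map_zero]

variable [IsLocalRing R]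

theorem exists_maximal_isRegular {J : Ideal R} (hJ : J ≤ maximalIdeal R) (rs : List R)
    (hrs : ∀ r ∈ rs, r ∈ J) (reg : IsWeaklyRegular R rs) :
    ∃ rs' : List R, (∀ r ∈ rs ++ rs', r ∈ J) ∧ IsRegular R (rs ++ rs') ∧
      ∃ Q, IsAssociatedPrime Q (R ⧸ Ideal.ofList (rs ++ rs')) ∧ J ≤ Q := by
  induction h : Ideal.ofList rs using WellFoundedGT.induction generalizing rs with
  | _ I ih =>
  subst h
  obtain ⟨x, hx, x_reg⟩ | hQ :=
    exists_mem_isSMulRegular_or_exists_isAssociatedPrime J (R ⧸ Ideal.ofList rs)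
  · have mem_J : ∀ r ∈ rs ++ [x], r ∈ J := by
      simpa [or_imp, forall_and] using ⟨hrs, hx⟩
    have reg_x : IsWeaklyRegular R (rs ++ [x]) := by
      rw [isWeaklyRegular_append_iff, isWeaklyRegular_singleton_iff]
      exact ⟨reg, ((quotientOfListEquiv rs).isSMulRegular_congr x).1 x_reg⟩
    have rs_ne_top : Ideal.ofList rs ≠ ⊤ := ofList_ne_top_of_isRegular <|
      IsRegular.of_isWeaklyRegular_of_mem_maximalIdeal R (fun r hr => hJ (hrs r hr)) reg
    have lt : Ideal.ofList rs < Ideal.ofList (rs ++ [x]) := by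
      rw [Ideal.ofList_append, Ideal.ofList_singleton, left_lt_sup,
        Ideal.span_singleton_le_iff_mem]
      intro x_mem
      have one_eq_zero : (1 : R ⧸ Ideal.ofList rs) = 0 := x_reg <| by
        simp only [smul_quotient_eq_zero x_mem]
      exact rs_ne_top (Ideal.Quotient.zero_eq_one_iff.1 one_eq_zero.symm)
    obtain ⟨rs', h⟩ := ih _ lt (rs ++ [x]) mem_J reg_x rfl
    rw [List.append_assoc] at h
    exact ⟨x :: rs', h⟩
  · refine ⟨[], ?_⟩
    rw [List.append_nil]
    exact ⟨hrs, IsRegular.of_isWeaklyRegular_of_mem_maximalIdeal R (fun r hr => hJ (hrs r hr)) reg,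
      hQ⟩

open scoped Pointwise in
theorem exists_smul_eq_zero_notMem_smul_top {M : Type u} [AddCommGroup M] [Module R M]
    [Module.Finite R M] {y : R} (hy : y ∈ maximalIdeal R) (reg : IsSMulRegular M y) {P : Ideal R}
    {m : M} (hm : m ≠ 0) (hP : ∀ a ∈ P, a • m = 0) :
    ∃ n : M, (∀ a ∈ P, a • n = 0) ∧ n ∉ y • (⊤ : Submodule R M) := by
  let N := Submodule.torsionBySet R M (P : Set R)
  have mem_N {n : M} : n ∈ N ↔ ∀ a ∈ P, a • n = 0 := by
    simp [N, Submodule.mem_torsionBySet_iff]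
  by_contra! h
  have N_le : N ≤ Ring.jacobson R • N := fun n hn => by
    obtain ⟨n', -, rfl⟩ := (Submodule.mem_smul_pointwise_iff_exists _ _ _).1 (h n (mem_N.1 hn))
    refine Submodule.smul_mem_smul (by rwa [ringJacobson_eq_maximalIdeal]) (mem_N.2 fun a ha => ?_)
    apply reg
    simp only
    rw [smul_comm, mem_N.1 hn a ha, smul_zero]
  have N_eq_bot : N = ⊥ := (IsNoetherian.noetherian N).eq_bot_of_le_jacobson_smul N_le
  exact hm ((Submodule.mem_bot R).1 (N_eq_bot ▸ mem_N.2 hP))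

open scoped Pointwise in
theorem exists_isAssociatedPrime_quotSMulTop {M : Type u} [AddCommGroup M] [Module R M]
    [Module.Finite R M] {y : R} (hy : y ∈ maximalIdeal R) (reg : IsSMulRegular M y) {P : Ideal R}
    (hP : IsAssociatedPrime P M) :
    ∃ Q, IsAssociatedPrime Q (QuotSMulTop y M) ∧ P ≤ Q ∧ y ∈ Q := by
  obtain ⟨P_prime, m, rfl⟩ := isAssociatedPrime_iff.1 hP
  have hm : m ≠ 0 := by
    rintro rfl
    exact P_prime.ne_top (by simp)
  obtain ⟨n, n_torsion, hn⟩ := exists_smul_eq_zero_notMem_smul_top hy reg hm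
    (fun a ha => (Submodule.mem_bot R).1 (Submodule.mem_colon_singleton.1 ha))
  obtain ⟨Q, hQ, le_Q⟩ := exists_le_isAssociatedPrime_of_isNoetherianRing R
    (Submodule.Quotient.mk n : QuotSMulTop y M) ((Submodule.Quotient.mk_eq_zero _).not.2 hn)
  have mem_Q {a : R} (ha : a • n ∈ y • (⊤ : Submodule R M)) : a ∈ Q := by
    apply le_Q
    rwa [Submodule.mem_colon_singleton, Submodule.mem_bot, ← Submodule.Quotient.mk_smul,
      Submodule.Quotient.mk_eq_zero]
  refine ⟨Q, hQ, fun a ha => mem_Q ?_, mem_Q (Submodule.smul_mem_pointwise_smul _ _ _ trivial)⟩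
  rw [n_torsion a ha]
  exact Submodule.zero_mem _

theorem length_le_ringKrullDim_of_isAssociatedPrime {M : Type u} [AddCommGroup M] [Module R M]
    [Module.Finite R M] {rs : List R} (hrs : ∀ r ∈ rs, r ∈ maximalIdeal R)
    (reg : IsWeaklyRegular M rs) {P : Ideal R} (hP : IsAssociatedPrime P M) :
    (rs.length : WithBot ℕ∞) ≤ ringKrullDim (R ⧸ P) := by
  induction rs generalizing M P with
  | nil =>
    have := hP.isPrime
    simpa using ringKrullDim_nonneg_of_nontrivial (R := R ⧸ P)
  | cons y rs ih =>
    have := hP.isPrime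
    rw [isWeaklyRegular_cons_iff] at reg
    rw [List.forall_mem_cons] at hrs
    have y_notMem : y ∉ P := isSMulRegular_iff_forall_notMem_associatedPrimes.1 reg.1 P hP
    obtain ⟨Q, hQ, P_le_Q, y_mem⟩ := exists_isAssociatedPrime_quotSMulTop hrs.1 reg.1 hP
    calc ((y :: rs).length : WithBot ℕ∞) = rs.length + 1 := by simp
      _ ≤ ringKrullDim (R ⧸ Q) + 1 := by gcongr; exact ih hrs.2 reg.2 hQ
      _ ≤ ringKrullDim (R ⧸ P) := by
        refine ringKrullDim_succ_le_of_surjective (Ideal.Quotient.factor P_le_Q)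
          (Ideal.Quotient.factor_surjective P_le_Q) (r := Ideal.Quotient.mk P y) ?_ ?_
        · rwa [mem_nonZeroDivisors_iff_ne_zero, Ne, Ideal.Quotient.eq_zero_iff_mem]
        · rwa [Ideal.Quotient.factor_mk, Ideal.Quotient.eq_zero_iff_mem]

theorem supportDim_le_length {M : Type u} [AddCommGroup M] [Module R M] [Module.Finite R M]
    {xs : List R} (hxs : ∀ r ∈ xs, r ∈ maximalIdeal R)
    (hM : Module.support R M ∩ PrimeSpectrum.zeroLocus {r | r ∈ xs} ⊆ {closedPoint R}) :
    Module.supportDim R M ≤ xs.length := by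
  induction xs generalizing M with
  | nil =>
    have : Subsingleton (Module.support R M) :=
      Set.subsingleton_coe _ |>.2 (Set.subsingleton_singleton.anti (by simpa using hM))
    exact Order.krullDim_nonpos_of_subsingleton
  | cons x xs ih =>
    rw [List.forall_mem_cons] at hxs
    rw [← support_quotSMulTop_inter_zeroLocus] at hM
    calc Module.supportDim R M ≤ Module.supportDim R (QuotSMulTop x M) + 1 :=
          Module.supportDim_le_supportDim_quotSMulTop_succ hxs.1
      _ ≤ xs.length + 1 := by gcongr; exact ih hxs.2 hM
      _ = (x :: xs).length := by simp

/-- By Rees's theorem there is a regular sequence `ys` with `|ys| = |xs|`; an associated prime `P`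
of `M` containing the first element of `xs` would then satisfy `|xs| ≤ dim R ⧸ P < |xs|`. -/
theorem isWeaklyRegular_of_subsingleton_ext {M : Type u} [AddCommGroup M] [Module R M]
    [Module.Finite R M] {xs : List R} (hxs : ∀ r ∈ xs, r ∈ maximalIdeal R)
    (hM : Module.support R M ∩ PrimeSpectrum.zeroLocus {r | r ∈ xs} ⊆ {closedPoint R})
    (hExt : ∀ i < xs.length,
      Subsingleton (Ext (ModuleCat.of R (R ⧸ maximalIdeal R)) (ModuleCat.of R M) i)) :
    IsWeaklyRegular M xs := by
  induction xs generalizing M with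
  | nil => simp
  | cons x xs ih =>
    cases subsingleton_or_nontrivial M
    · exact ⟨fun _ _ => Function.injective_of_subsingleton _⟩
    have x_reg : IsSMulRegular M x := by
      rw [isSMulRegular_iff_forall_notMem_associatedPrimes]
      intro P hP x_mem
      have : P.IsPrime := IsAssociatedPrime.isPrime hP
      obtain ⟨ys, ys_length, ys_mem, ys_reg⟩ :=
        ModuleCat.exists_isRegular_of_exists_subsingleton_ext (maximalIdeal R) _ (ModuleCat.of R M)
          (maximalIdeal_smul_top_lt_top M) (ModuleCat.of R (R ⧸ maximalIdeal R))
          support_quotient_maximalIdeal hExt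
      have ys_length_le := length_le_ringKrullDim_of_isAssociatedPrime ys_mem ys_reg.1 hP
      have dim_le := supportDim_le_length (M := R ⧸ P) (List.forall_mem_cons.1 hxs).2 <| by
        refine Set.Subset.trans (fun Q hQ => ?_) hM
        rw [Set.mem_inter_iff, Module.mem_support_iff_of_finite, Ideal.annihilator_quotient] at hQ
        rw [Set.mem_inter_iff, Module.mem_support_iff_of_finite]
        have annihilator_le : Module.annihilator R M ≤ P :=
          Submodule.annihilator_top (R := R) (M := M) ▸ IsAssociatedPrime.annihilator_le hP
        exact ⟨annihilator_le.trans hQ.1, List.forall_mem_cons.2 ⟨hQ.1 x_mem, hQ.2⟩⟩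
      rw [Module.supportDim_quotient_eq_ringKrullDim] at dim_le
      have : (xs.length + 1 : WithBot ℕ∞) ≤ xs.length := by
        simpa [ys_length] using ys_length_le.trans dim_le
      norm_cast at this
      simp at this
    rw [isWeaklyRegular_cons_iff]
    rw [← support_quotSMulTop_inter_zeroLocus] at hM
    refine ⟨x_reg, ih (List.forall_mem_cons.1 hxs).2 hM fun i hi => ?_⟩
    have := hExt i (Nat.lt_succ_of_lt hi)
    have := hExt (i + 1) (Nat.succ_lt_succ hi)
    exact subsingleton_ext_quotSMulTop (M := ModuleCat.of R M) x_reg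

end Depth

/-! ### Finite injective dimension -/

/-- `R ⧸ rs` is self-injective: a linear map `N' → R ⧸ rs` is a class in `Ext^|rs| (N', R)`, and
the obstruction to extending it lies in `Ext^(|rs|+1) (N ⧸ N', R) = 0`. -/
theorem exists_comp_subtype_eq {R : Type u} [CommRing R] {rs : List R}
    (reg : IsWeaklyRegular R rs)
    (hR : ExtVanishing (ModuleCat.of R R) (rs.length + 1)) {N : Type u} [AddCommGroup N]
    [Module R N] [Module.Finite R N] (hN : ∀ r ∈ rs, ∀ n : N, r • n = 0) (N' : Submodule R N)
    (φ : N' →ₗ[R] R ⧸ Ideal.ofList rs) :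
    ∃ ψ : N →ₗ[R] R ⧸ Ideal.ofList rs, ψ ∘ₗ N'.subtype = φ := by
  obtain ⟨η, hη⟩ := exists_ext_comp_bijective (ModuleCat.of R R) rs reg
  let e := quotientOfListEquiv rs
  let S : ShortComplex (ModuleCat.{u} R) :=
    ModuleCat.shortComplexOfCompEqZero N'.subtype N'.mkQ 
      (LinearMap.exact_subtype_mkQ N').linearMap_comp_eq_zero
  have hS : S.ShortExact := ModuleCat.shortComplex_shortExact S
    (LinearMap.exact_subtype_mkQ N') N'.subtype_injective N'.mkQ_surjective
  let φ' : ModuleCat.of R N' ⟶ ModuleCat.of R (R ⧸ Ideal.ofList rs • (⊤ : Submodule R R)) :=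
    ModuleCat.ofHom (e.toLinearMap ∘ₗ φ)
  have obstruction : Subsingleton (Ext S.X₃ (ModuleCat.of R R) (rs.length + 1)) :=
    hR S.X₃ (inferInstanceAs (Module.Finite R (N ⧸ N'))) _ le_rfl
  obtain ⟨y, hy⟩ := Ext.contravariant_sequence_exact₁ hS (ModuleCat.of R R)
    ((Ext.mk₀ φ').comp η (zero_add _)) (add_comm 1 _) (obstruction.elim _ _)
  obtain ⟨ψ, rfl⟩ := (hη (ModuleCat.of R N) hN).2 y
  have comp_eq : ModuleCat.ofHom N'.subtype ≫ ψ = φ' := by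
    apply (hη (ModuleCat.of R N') fun r hr a => Subtype.ext (hN r hr a)).1
    change (Ext.mk₀ _).comp η _ = (Ext.mk₀ _).comp η _
    rw [← hy, ← Ext.mk₀_comp_mk₀, Ext.comp_assoc _ _ _ (zero_add 0) (zero_add _) (by simp)]
  refine ⟨e.symm.toLinearMap ∘ₗ ψ.hom, LinearMap.ext fun n => ?_⟩
  have apply_eq : ψ.hom n = e (φ n) := congrArg (fun g : ModuleCat.of R N' ⟶ _ => g.hom n) comp_eq
  exact e.symm_apply_eq.2 apply_eq

section Gorenstein

variable {R : Type u} [CommRing R] [IsLocalRing R]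

theorem zeroLocus_eq_singleton_closedPoint {I : Ideal R} (hI : I.radical = maximalIdeal R) :
    PrimeSpectrum.zeroLocus (I : Set R) = {closedPoint R} := by
  rw [← PrimeSpectrum.zeroLocus_radical, hI, PrimeSpectrum.zeroLocus_eq_singleton]
  rfl

theorem ringKrullDim_quotient_eq_zero {I : Ideal R} (hI : I.radical = maximalIdeal R) :
    ringKrullDim (R ⧸ I) = 0 := by
  rw [← Module.supportDim_quotient_eq_ringKrullDim, Module.supportDim, Module.support_eq_zeroLocus,
    Ideal.annihilator_quotient, zeroLocus_eq_singleton_closedPoint hI]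
  exact Order.krullDim_eq_zero

theorem IsGorensteinLocal.exists_extVanishing (hR : IsGorensteinLocal R) :
    ∃ n, ExtVanishing (ModuleCat.of R R) n := by
  obtain ⟨n, hn⟩ := hR
  exact ⟨n + 1, fun N _ i hi => HasInjectiveDimensionLT.subsingleton _ (n + 1) i hi N⟩

variable [IsNoetherianRing R]

theorem IsGorensteinLocal.exists_append (hR : IsGorensteinLocal R) (rs : List R)
    (hrs : ∀ r ∈ rs, r ∈ maximalIdeal R) (reg : IsWeaklyRegular R rs) :
    ∃ rs' : List R, IsRegular R (rs ++ rs') ∧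
      ExtVanishing (ModuleCat.of R R) ((rs ++ rs').length + 1) ∧
      (Ideal.ofList (rs ++ rs')).radical = maximalIdeal R ∧
      ringKrullDim R = (rs ++ rs').length := by
  obtain ⟨n, hn⟩ := hR.exists_extVanishing
  obtain ⟨rs', -, reg', Q, hQ, le_Q⟩ := exists_maximal_isRegular le_rfl rs hrs reg
  obtain rfl : maximalIdeal R = Q := (maximalIdeal.isMaximal R).eq_of_le hQ.isPrime.ne_top le_Q
  have vanishing := hn.of_isAssociatedPrime_quotient reg' hQ
  have radical_eq := radical_ofList_eq_maximalIdeal reg' vanishing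
  refine ⟨rs', reg', vanishing, radical_eq, ?_⟩
  rw [← ringKrullDim_add_length_eq_ringKrullDim_of_isRegular _ reg',
    ringKrullDim_quotient_eq_zero radical_eq, zero_add]

theorem IsGorensteinLocal.isRegular_and_extVanishing (hR : IsGorensteinLocal R) {xs : List R}
    (hdim : ringKrullDim R = xs.length) (hrad : (Ideal.ofList xs).radical = maximalIdeal R) :
    IsRegular R xs ∧ ExtVanishing (ModuleCat.of R R) (xs.length + 1) := by
  obtain ⟨ys, ys_reg, vanishing, ys_rad, ys_dim⟩ := hR.exists_append [] (by simp) (by simp)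
  rw [List.nil_append] at ys_reg vanishing ys_rad ys_dim
  have length_eq : xs.length = ys.length := by exact_mod_cast hdim.symm.trans ys_dim
  have mem_maximalIdeal {zs : List R} (h : (Ideal.ofList zs).radical = maximalIdeal R) :
      ∀ r ∈ zs, r ∈ maximalIdeal R := fun r hr => h ▸ Ideal.le_radical (Ideal.subset_span hr)
  refine ⟨IsRegular.of_isWeaklyRegular_of_mem_maximalIdeal R (mem_maximalIdeal hrad)
    (isWeaklyRegular_of_subsingleton_ext (mem_maximalIdeal hrad) ?_ fun i hi => ?_),
    length_eq ▸ vanishing⟩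
  · rw [← zeroLocus_eq_singleton_closedPoint hrad, Ideal.ofList, PrimeSpectrum.zeroLocus_span]
    exact Set.inter_subset_right
  · exact subsingleton_ext_of_isWeaklyRegular (M := ModuleCat.of R R) ys_reg.1
      (fun r hr => smul_quotient_eq_zero (mem_maximalIdeal ys_rad r hr)) (length_eq ▸ hi)

theorem exists_linearMap_span_singleton_apply_ne_zero {M N : Type u} [AddCommGroup M] [Module R M]
    [AddCommGroup N] [Module R N] (hM : IsAssociatedPrime (maximalIdeal R) M) {n : N} (hn : n ≠ 0) :
    ∃ φ : Submodule.span R {n} →ₗ[R] M, φ ⟨n, Submodule.mem_span_singleton_self n⟩ ≠ 0 := by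
  obtain ⟨f, hf⟩ := ((isAssociatedPrime_iff_exists_injective_linearMap _ _).1 hM).2
  have torsionOf_le : Ideal.torsionOf R N n ≤ maximalIdeal R :=
    le_maximalIdeal fun h => hn ((Ideal.torsionOf_eq_top_iff R n).1 h)
  let e := Ideal.quotTorsionOfEquivSpanSingleton R N n
  refine ⟨f ∘ₗ Submodule.factor torsionOf_le ∘ₗ e.symm.toLinearMap, fun h => ?_⟩
  have e_symm : e.symm ⟨n, Submodule.mem_span_singleton_self n⟩ = Submodule.Quotient.mk 1 := by
    rw [LinearEquiv.symm_apply_eq]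
    ext
    rw [Ideal.quotTorsionOfEquivSpanSingleton_apply_mk]
    exact (one_smul R n).symm
  have f_one : f (Submodule.Quotient.mk 1) = 0 := by
    rwa [LinearMap.comp_apply, LinearMap.comp_apply, LinearEquiv.coe_coe, e_symm] at h
  exact one_ne_zero (α := R ⧸ maximalIdeal R) (hf (f_one.trans (map_zero f).symm))

theorem exists_linearMap_apply_ne_zero {rs : List R} (reg : IsRegular R rs)
    (hR : ExtVanishing (ModuleCat.of R R) (rs.length + 1)) {N : Type u} [AddCommGroup N]
    [Module R N] [Module.Finite R N] (hN : ∀ r ∈ rs, ∀ n : N, r • n = 0) {n : N} (hn : n ≠ 0) :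
    ∃ ψ : N →ₗ[R] R ⧸ Ideal.ofList rs, ψ n ≠ 0 := by
  have := Ideal.Quotient.nontrivial_iff.2 (ofList_ne_top_of_isRegular reg)
  obtain ⟨Q, hQ⟩ := associatedPrimes.nonempty R (R ⧸ Ideal.ofList rs)
  rw [eq_maximalIdeal_of_isAssociatedPrime_quotient_ofList reg hR hQ] at hQ
  obtain ⟨φ, hφ⟩ := exists_linearMap_span_singleton_apply_ne_zero hQ hn
  obtain ⟨ψ, rfl⟩ := exists_comp_subtype_eq reg.1 hR hN _ φ
  exact ⟨ψ, hφ⟩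

end Gorenstein

/-! ### Systems of parameters and closure operations -/

section Parameters

theorem ofList_ofFn {R : Type*} [Semiring R] {d : ℕ} (x : Fin d → R) :
    Ideal.ofList (List.ofFn x) = Ideal.span (Set.range x) :=
  congrArg Ideal.span (Set.ext fun _ => List.mem_ofFn)

theorem radical_span_image_pow {R : Type*} [CommSemiring R] (s : Set R) {n : ℕ} (hn : n ≠ 0) :
    (Ideal.span ((· ^ n) '' s)).radical = (Ideal.span s).radical := by
  refine le_antisymm (Ideal.radical_mono (Ideal.span_le.2 ?_))
    (Ideal.radical_le_radical_iff.2 (Ideal.span_le.2 fun a ha => ?_))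
  · rintro _ ⟨a, ha, rfl⟩
    exact Ideal.pow_mem_of_mem _ (Ideal.subset_span ha) n hn.pos
  · exact Ideal.mem_radical_of_pow_mem
      (Ideal.le_radical (Ideal.subset_span (Set.mem_image_of_mem _ ha)))

theorem exists_linearMap_quotient_apply_eq {R M : Type*} [CommRing R] [AddCommGroup M] [Module R M]
    {I : Ideal R} {J : Submodule R M} (g : R ⧸ I →ₗ[R] M ⧸ J) :
    ∃ y : M, ∀ a : R, g (Ideal.Quotient.mk I a) = J.mkQ (a • y) := by
  obtain ⟨y, hy⟩ := J.mkQ_surjective (g 1)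
  refine ⟨y, fun a => ?_⟩
  rw [map_smul, hy, ← map_smul]
  exact congrArg g (by rw [Algebra.smul_def, mul_one]; rfl)

theorem ClosureOperation.Residual.cl_eq_self_iff {R : Type u} [CommRing R] {c : ClosureOperation R}
    (hc : c.Residual) {M : Type u} [AddCommGroup M] [Module R M] [Module.Finite R M]
    (L : Submodule R M) : c.cl M L = L ↔ c.cl (M ⧸ L) ⊥ = ⊥ := by
  have comap_eq := hc M (M ⧸ L) L.mkQ L.mkQ_surjective
  rw [L.ker_mkQ] at comap_eq
  rw [← (Submodule.comap_injective_of_surjective L.mkQ_surjective).eq_iff, ← comap_eq,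
    Submodule.comap_bot, L.ker_mkQ]

variable {R : Type u} [CommRing R] [IsLocalRing R] {d : ℕ} {x : Fin d → R}

theorem IsSystemOfParameters.mem_maximalIdeal (hx : IsSystemOfParameters R x) (i : Fin d) :
    x i ∈ maximalIdeal R :=
  hx.2 ▸ Ideal.le_radical (Ideal.subset_span (Set.mem_range_self i))

theorem IsSystemOfParameters.pow (hx : IsSystemOfParameters R x) {t : ℕ} (ht : t ≠ 0) :
    IsSystemOfParameters R fun i => x i ^ t :=
  ⟨hx.1, by
    rw [show (fun i => x i ^ t) = (· ^ t) ∘ x from rfl, Set.range_comp,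
      radical_span_image_pow _ ht, hx.2]⟩

theorem IsSystemOfParameters.span_pow_le (hx : IsSystemOfParameters R x) {n t : ℕ} (ht : n ≤ t) :
    Ideal.span (Set.range fun i => x i ^ t) ≤ maximalIdeal R ^ n := by
  rw [Ideal.span_le]
  rintro _ ⟨i, rfl⟩
  exact Ideal.pow_le_pow_right ht (Ideal.pow_mem_pow (hx.mem_maximalIdeal i) t)

variable [IsNoetherianRing R]

theorem exists_notMem_maximalIdeal_pow_smul_top {M : Type*} [AddCommGroup M] [Module R M]
    [Module.Finite R M] {m : M} (hm : m ≠ 0) :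
    ∃ n, m ∉ maximalIdeal R ^ n • (⊤ : Submodule R M) := by
  by_contra! mem_pow
  apply hm
  rw [← Submodule.mem_bot R, ← Ideal.iInf_pow_smul_eq_bot_of_isLocalRing (M := M) (maximalIdeal R)
    (Ideal.IsPrime.ne_top inferInstance)]
  exact (Submodule.mem_iInf _).2 mem_pow

theorem IsGorensteinLocal.isRegular_of_isSystemOfParameters (hR : IsGorensteinLocal R)
    (hx : IsSystemOfParameters R x) :
    IsRegular R (List.ofFn x) ∧
      ExtVanishing (ModuleCat.of R R) ((List.ofFn x).length + 1) :=
  hR.isRegular_and_extVanishing (by rw [hx.1, List.length_ofFn]) (by rw [ofList_ofFn, hx.2])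

theorem IsGorensteinLocal.exists_isSystemOfParameters (hR : IsGorensteinLocal R) :
    ∃ (d : ℕ) (x : Fin d → R), IsSystemOfParameters R x := by
  obtain ⟨ys, -, -, radical_eq, dim_eq⟩ := hR.exists_append [] (by simp) (by simp)
  exact ⟨ys.length, ys.get, dim_eq, by rw [← ofList_ofFn, List.ofFn_get]; exact radical_eq⟩

theorem IsGorensteinLocal.exists_linearMap_quotient_pow (hR : IsGorensteinLocal R)
    (hx : IsSystemOfParameters R x) {T : Set ℕ} (hT : T.Infinite) {M : Type u} [AddCommGroup M]
    [Module R M] [Module.Finite R M] {m : M} (hm : m ≠ 0) :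
    ∃ t ∈ T, ∃ g : M →ₗ[R] R ⧸ Ideal.span (Set.range fun i => x i ^ t), g m ≠ 0 := by
  obtain ⟨n, hn⟩ := exists_notMem_maximalIdeal_pow_smul_top (R := R) hm
  obtain ⟨t, htT, ht⟩ := hT.exists_gt n
  obtain ⟨reg, vanishing⟩ :=
    hR.isRegular_of_isSystemOfParameters (hx.pow (Nat.ne_zero_of_lt ht))
  refine ⟨t, htT, ?_⟩
  rw [← ofList_ofFn]
  let J := Ideal.ofList (List.ofFn fun i => x i ^ t)
  have J_le : J ≤ maximalIdeal R ^ n := (ofList_ofFn _).trans_le (hx.span_pow_le ht.le)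
  have mkQ_ne_zero : (J • (⊤ : Submodule R M)).mkQ m ≠ 0 := fun h =>
    hn (Submodule.smul_mono_left J_le ((Submodule.Quotient.mk_eq_zero _).1 h))
  have smul_eq_zero : ∀ r ∈ List.ofFn fun i => x i ^ t,
      ∀ a : M ⧸ J • (⊤ : Submodule R M), r • a = 0 := by
    intro r hr a
    obtain ⟨a, rfl⟩ := Submodule.mkQ_surjective _ a
    rw [← map_smul]
    exact (Submodule.Quotient.mk_eq_zero _).2
      (Submodule.smul_mem_smul (Ideal.subset_span hr) trivial)
  obtain ⟨ψ, hψ⟩ := exists_linearMap_apply_ne_zero reg vanishing smul_eq_zero mkQ_ne_zero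
  exact ⟨ψ ∘ₗ Submodule.mkQ _, hψ⟩

theorem IsGorensteinLocal.closure_subset (hR : IsGorensteinLocal R) {cl : Ideal R → Set R}
    (hcl : ∀ (I J : Ideal R) (y u : R), (∀ a ∈ I, a * y ∈ J) → u ∈ cl I → u * y ∈ cl J)
    (hx : IsSystemOfParameters R x) {T : Set ℕ} (hT : T.Infinite)
    (hclosed : ∀ t ∈ T, cl (Ideal.span (Set.range fun i => x i ^ t)) ⊆
      (Ideal.span (Set.range fun i => x i ^ t) : Ideal R)) (I : Ideal R) : cl I ⊆ I := by
  intro u hu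
  by_contra huI
  have mk_ne_zero : Ideal.Quotient.mk I u ≠ 0 := fun h => huI (Ideal.Quotient.eq_zero_iff_mem.1 h)
  obtain ⟨t, ht, g, hg⟩ := hR.exists_linearMap_quotient_pow hx hT mk_ne_zero
  obtain ⟨y, g_mk⟩ := exists_linearMap_quotient_apply_eq g
  have mul_mem (a : R) (ha : a ∈ I) : a * y ∈ Ideal.span (Set.range fun i => x i ^ t) := by
    rw [← smul_eq_mul, ← Submodule.Quotient.mk_eq_zero, ← Submodule.mkQ_apply, ← g_mk,
      Ideal.Quotient.eq_zero_iff_mem.2 ha, map_zero]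
  refine hg ((g_mk u).trans ((Submodule.Quotient.mk_eq_zero _).2 ?_))
  exact hclosed t ht (hcl I _ y u mul_mem hu)

theorem IsGorensteinLocal.cl_bot (hR : IsGorensteinLocal R) {c : ClosureOperation R}
    (functorial : c.Functorial) (residual : c.Residual) (hx : IsSystemOfParameters R x)
    (hT : {t : ℕ | c.cl R (Ideal.span (Set.range fun i => x i ^ t)) =
      Ideal.span (Set.range fun i => x i ^ t)}.Infinite)
    (M : Type u) [AddCommGroup M] [Module R M] [Module.Finite R M] :
    c.cl M (⊥ : Submodule R M) = ⊥ := by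
  refine (Submodule.eq_bot_iff _).2 fun m hm => ?_
  by_contra m_ne
  obtain ⟨t, closed, g, hg⟩ := hR.exists_linearMap_quotient_pow hx hT m_ne
  apply hg
  rw [← Submodule.mem_bot R, ← (residual.cl_eq_self_iff _).1 closed, ← Submodule.map_bot g]
  exact functorial M _ g ⊥ (Submodule.mem_map_of_mem hm)

end Parameters

/-! ### Tight closure in prime characteristic -/

section TightClosure

variable {S S' : Type*} [CommRing S] [CommRing S']

theorem pow_mem_bracketPower {I : Ideal S} {a : S} (ha : a ∈ I) (q : ℕ) :
    a ^ q ∈ bracketPower I q :=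
  Ideal.subset_span (Set.mem_image_of_mem _ ha)

theorem subset_tightClosure (p : ℕ) (I : Ideal S) : (I : Set S) ⊆ tightClosure p I :=
  fun _ hu => ⟨1, fun _ hP => (Ideal.ne_top_iff_one _).1 hP.1.1.ne_top, 0, fun e _ => by
    rw [one_mul]
    exact pow_mem_bracketPower hu _⟩

theorem map_mul_pow_mem_bracketPower {f : S →+* S'} {I : Ideal S} {J : Ideal S'} {y : S'}
    (h : ∀ a ∈ I, f a * y ∈ J) (q : ℕ) {v : S} (hv : v ∈ bracketPower I q) :
    f v * y ^ q ∈ bracketPower J q := by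
  induction hv using Submodule.span_induction with
  | mem v hv =>
    obtain ⟨a, ha, rfl⟩ := hv
    rw [map_pow, ← mul_pow]
    exact pow_mem_bracketPower (h a ha) q
  | zero => rw [map_zero, zero_mul]; exact zero_mem _
  | add v w _ _ hv hw => rw [map_add, add_mul]; exact add_mem hv hw
  | smul r v _ hv =>
    rw [smul_eq_mul, map_mul, mul_assoc]
    exact Ideal.mul_mem_left _ _ hv

theorem map_mul_mem_tightClosure {p : ℕ} {f : S →+* S'}
    (hf : ∀ Q ∈ minimalPrimes S', Q.comap f ∈ minimalPrimes S) {I : Ideal S} {J : Ideal S'} {y : S'}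
    (h : ∀ a ∈ I, f a * y ∈ J) {u : S} (hu : u ∈ tightClosure p I) :
    f u * y ∈ tightClosure p J := by
  obtain ⟨c, hc, e₀, he⟩ := hu
  refine ⟨f c, fun Q hQ hcQ => hc _ (hf Q hQ) hcQ, e₀, fun e e₀_le => ?_⟩
  rw [mul_pow, ← map_pow, ← mul_assoc, ← map_mul]
  exact map_mul_pow_mem_bracketPower h _ (he e e₀_le)

theorem mul_mem_tightClosure {p : ℕ} {I J : Ideal S} {y u : S} (h : ∀ a ∈ I, a * y ∈ J)
    (hu : u ∈ tightClosure p I) : u * y ∈ tightClosure p J :=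
  map_mul_mem_tightClosure (f := RingHom.id S) (fun _ hQ => hQ) h hu

theorem IsGorensteinLocal.tightClosure_eq {R : Type u} [CommRing R] [IsLocalRing R]
    [IsNoetherianRing R] (hR : IsGorensteinLocal R) {p d : ℕ} {x : Fin d → R}
    (hx : IsSystemOfParameters R x)
    (hclosed : ∀ t, t ≠ 0 → tightClosure p (Ideal.span (Set.range fun i => x i ^ t)) ⊆
      (Ideal.span (Set.range fun i => x i ^ t) : Ideal R)) (I : Ideal R) :
    tightClosure p I = I :=
  (hR.closure_subset (fun _ _ _ _ => mul_mem_tightClosure) hx (Set.Ioi_infinite 0)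
    (fun t ht => hclosed t (Nat.ne_of_gt ht)) I).antisymm (subset_tightClosure p I)

end TightClosure

/-! ### Tight closure in equal characteristic zero -/

section GoingDown

variable {D D' : Type*} [CommRing D] [CommRing D'] [Algebra D D'] [Algebra.HasGoingDown D D']

theorem under_mem_minimalPrimes_of_mem_minimalPrimes_map {I : Ideal D} {Q : Ideal D'}
    (hQ : Q ∈ (I.map (algebraMap D D')).minimalPrimes) : Q.under D ∈ I.minimalPrimes := by
  have := hQ.1.1
  refine ⟨⟨inferInstance, Ideal.map_le_iff_le_comap.1 hQ.1.2⟩, fun p ⟨_, I_le⟩ p_le => ?_⟩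
  obtain ⟨P, P_le, _, P_over⟩ := Ideal.exists_ideal_le_liesOver_of_le (p := p) Q p_le
  have map_le : I.map (algebraMap D D') ≤ P :=
    Ideal.map_le_iff_le_comap.2 (I_le.trans P_over.over.le)
  exact (Ideal.comap_mono (hQ.2 ⟨inferInstance, map_le⟩ P_le)).trans P_over.over.ge

theorem comap_quotientMap_mem_minimalPrimes (I : Ideal D) {Q : Ideal (D' ⧸ I.map (algebraMap D D'))}
    (hQ : Q ∈ minimalPrimes (D' ⧸ I.map (algebraMap D D'))) :
    Q.comap (Ideal.quotientMap _ (algebraMap D D') Ideal.le_comap_map) ∈ minimalPrimes (D ⧸ I) := by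
  have comap_mem : Q.comap (Ideal.Quotient.mk _) ∈ (I.map (algebraMap D D')).minimalPrimes := by
    rw [Ideal.minimalPrimes_eq_comap]
    exact Set.mem_image_of_mem _ hQ
  have under_mem := under_mem_minimalPrimes_of_mem_minimalPrimes_map comap_mem
  rw [Ideal.minimalPrimes_eq_comap] at under_mem
  obtain ⟨Q₀, hQ₀, comap_eq⟩ := under_mem
  convert hQ₀
  exact (Ideal.comap_injective_of_surjective _ Ideal.Quotient.mk_surjective comap_eq).symm

theorem mk_map_algebraMap_mul_mem_tightClosure {A : Type*} [CommRing A] [Algebra A D]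
    [Algebra A D'] [IsScalarTower A D D'] {μ : Ideal A} {p : ℕ} {J : Ideal D} {J' : Ideal D'}
    {y : D'} (h : ∀ a ∈ J, algebraMap D D' a * y ∈ J') {t : D}
    (ht : Ideal.Quotient.mk (μ.map (algebraMap A D)) t ∈
      tightClosure p (J.map (Ideal.Quotient.mk _))) :
    Ideal.Quotient.mk (μ.map (algebraMap A D')) (algebraMap D D' t * y) ∈
      tightClosure p (J'.map (Ideal.Quotient.mk _)) := by
  rw [show μ.map (algebraMap A D') = (μ.map (algebraMap A D)).map (algebraMap D D') by
    rw [Ideal.map_map, IsScalarTower.algebraMap_eq A D D']]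
  rw [map_mul, ← Ideal.quotientMap_mk (H := Ideal.le_comap_map)]
  refine map_mul_mem_tightClosure (fun _ => comap_quotientMap_mem_minimalPrimes _)
    (fun z hz => ?_) ht
  obtain ⟨a, ha, rfl⟩ := (Ideal.mem_map_iff_of_surjective _ Ideal.Quotient.mk_surjective).1 hz
  rw [Ideal.quotientMap_mk, ← map_mul]
  exact Ideal.mem_map_of_mem _ (h a ha)

end GoingDown

section EqualCharacteristicZero

variable {K : Type v} [Field K]

/-- Adjoin to the finite type algebra `D` variables mapping to `y` and to generators of `J`; the
preimage of `J` in this polynomial ring over `D` then extends to `J`. -/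
theorem mul_mem_directTightClosure {C : Type u} [CommRing C] [Algebra K C] {I J : Ideal C}
    (hJ : J.FG) {y u : C} (h : ∀ a ∈ I, a * y ∈ J) (hu : u ∈ directTightClosure K I) :
    u * y ∈ directTightClosure K J := by
  obtain ⟨A, hA, D, _, _, _, φ, J₀, t, map_J₀, rfl, a, ha, mem_tightClosure⟩ := hu
  let _ : Algebra D C := φ.toRingHom.toAlgebra
  have : IsScalarTower A D C := .of_algebraMap_eq fun r => (φ.commutes r).symm
  obtain ⟨n, b, span_b⟩ := Submodule.fg_iff_exists_fin_generating_family.1 hJ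
  let ψ : MvPolynomial (Option (Fin n)) D →ₐ[A] C :=
    (MvPolynomial.aeval fun o => o.elim y b : MvPolynomial _ D →ₐ[D] C).restrictScalars A
  have ψ_none : ψ (.X none) = y := MvPolynomial.aeval_X _ _
  have ψ_some (i : Fin n) : ψ (.X (some i)) = b i := MvPolynomial.aeval_X _ _
  have ψ_C_mul (d : D) : ψ (.C d * .X none) = φ d * y := by
    rw [map_mul, ψ_none]
    exact congrArg (· * y) (MvPolynomial.aeval_C _ d)
  have finiteType : Algebra.FiniteType A (MvPolynomial (Option (Fin n)) D) :=
    Algebra.FiniteType.trans (S := D) inferInstance inferInstance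
  have map_comap : (J.comap ψ).map ψ = J := by
    refine Ideal.map_comap_le.antisymm ?_
    rw [← span_b, Submodule.span_le]
    rintro _ ⟨i, rfl⟩
    rw [← ψ_some]
    refine Ideal.mem_map_of_mem ψ ?_
    rw [Ideal.mem_comap, ψ_some]
    exact Submodule.subset_span (Set.mem_range_self i)
  have C_mul_mem : ∀ d ∈ J₀, .C d * .X none ∈ J.comap ψ := by
    intro d hd
    rw [Ideal.mem_comap, ψ_C_mul]
    exact h _ (map_J₀ ▸ Ideal.mem_map_of_mem φ hd)
  exact ⟨A, hA, _, inferInstance, inferInstance, finiteType, ψ, J.comap ψ, _,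
    map_comap, ψ_C_mul t, a, ha, fun μ hμ haμ p hp hpμ =>
      mk_map_algebraMap_mul_mem_tightClosure C_mul_mem (mem_tightClosure μ hμ haμ p hp hpμ)⟩

theorem one_mem_directTightClosure_top [CharZero K] {C : Type u} [CommRing C] [Algebra K C] :
    (1 : C) ∈ directTightClosure K (⊤ : Ideal C) := by
  let e : (⊥ : Subalgebra ℤ K) ≃ₐ[ℤ] ℤ :=
    Algebra.botEquivOfInjective (algebraMap ℤ K).injective_int
  let _ : Algebra (⊥ : Subalgebra ℤ K) ℤ := (e : (⊥ : Subalgebra ℤ K) →+* ℤ).toAlgebra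
  have finiteType : Algebra.FiniteType (⊥ : Subalgebra ℤ K) ℤ :=
    Algebra.FiniteType.of_surjective (Algebra.ofId _ _) e.surjective
  have commutes (r : (⊥ : Subalgebra ℤ K)) :
      Int.castRingHom C (algebraMap _ ℤ r) = algebraMap _ C r := by
    obtain ⟨n, rfl⟩ := e.symm.surjective r
    have e_apply : algebraMap (⊥ : Subalgebra ℤ K) ℤ (e.symm n) = n := e.apply_symm_apply n
    have e_symm : e.symm n = (n : (⊥ : Subalgebra ℤ K)) := e.symm.commutes n
    rw [e_apply, e_symm, map_intCast, eq_intCast]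
  refine ⟨⊥, Subalgebra.fg_bot, ℤ, inferInstance, inferInstance, finiteType,
    { Int.castRingHom C with commutes' := commutes }, ⊤, 1, Ideal.map_top _, map_one _, 1,
    one_ne_zero, fun μ _ _ p _ _ => subset_tightClosure p _ ?_⟩
  rw [Ideal.map_top]
  trivial

variable {R : Type u} [CommRing R] [IsNoetherianRing R] [Algebra K R]

theorem subset_zeroTightClosure [CharZero K] (I : Ideal R) :
    (I : Set R) ⊆ zeroTightClosure K I := by
  intro w hw P _
  rw [← one_mul (Ideal.Quotient.mk P w)]
  exact mul_mem_directTightClosure (IsNoetherian.noetherian _)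
    (fun a _ => Ideal.mul_mem_left _ a (Ideal.mem_map_of_mem _ hw)) one_mem_directTightClosure_top

theorem mul_mem_zeroTightClosure {I J : Ideal R} {y u : R} (h : ∀ a ∈ I, a * y ∈ J)
    (hu : u ∈ zeroTightClosure K I) : u * y ∈ zeroTightClosure K J := by
  intro P hP
  rw [map_mul]
  refine mul_mem_directTightClosure (IsNoetherian.noetherian _) (fun z hz => ?_) (hu P hP)
  obtain ⟨a, ha, rfl⟩ := (Ideal.mem_map_iff_of_surjective _ Ideal.Quotient.mk_surjective).1 hz
  rw [← map_mul]
  exact Ideal.mem_map_of_mem _ (h a ha)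

theorem IsGorensteinLocal.isFRegularZero [IsLocalRing R] (hR : IsGorensteinLocal R) [CharZero K]
    (hF : IsFRationalZero K R) : IsFRegularZero K R := by
  intro I
  obtain ⟨d, x, hx⟩ := hR.exists_isSystemOfParameters
  refine (hR.closure_subset (fun _ _ _ _ => mul_mem_zeroTightClosure) hx
    (Set.Ioi_infinite 0) (fun t ht => ?_) I).antisymm (subset_zeroTightClosure I)
  exact (hF d _ (hx.pow (Nat.ne_of_gt ht))).le

end EqualCharacteristicZero

/-! ### Localization -/

section BracketPower

variable {S S' : Type*} [CommRing S] [CommRing S'] {p : ℕ}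

theorem bracketPower_eq_map_iterateFrobenius [ExpChar S p] (I : Ideal S) (e : ℕ) :
    bracketPower I (p ^ e) = I.map (iterateFrobenius S p e) :=
  rfl

theorem bracketPower_map [ExpChar S p] [ExpChar S' p] (f : S →+* S') (I : Ideal S) (e : ℕ) :
    bracketPower (I.map f) (p ^ e) = (bracketPower I (p ^ e)).map f := by
  rw [bracketPower_eq_map_iterateFrobenius, bracketPower_eq_map_iterateFrobenius, Ideal.map_map,
    Ideal.map_map, RingHom.iterateFrobenius_comm]

theorem bracketPower_ofList [ExpChar S p] (xs : List S) (e : ℕ) :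
    bracketPower (Ideal.ofList xs) (p ^ e) = Ideal.ofList (xs.map (· ^ p ^ e)) :=
  Ideal.map_ofList (iterateFrobenius S p e) xs

end BracketPower

section PrimeAvoidance

variable {S : Type*} [CommRing S] [IsNoetherianRing S]

theorem exists_forall_mem_minimalPrimes_iff (I : Ideal S) (A : Set (Ideal S)) :
    ∃ r, ∀ Q ∈ I.minimalPrimes, r ∈ Q ↔ Q ∈ A := by
  classical
  let F := (Ideal.finite_minimalPrimes_of_isNoetherianRing S I).toFinset
  have mem_F {Q : Ideal S} : Q ∈ F ↔ Q ∈ I.minimalPrimes := Set.Finite.mem_toFinset _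
  have not_subset : ¬ (((F.filter (· ∈ A)).inf id : Ideal S) : Set S) ⊆
      ⋃ Q ∈ (F.filter (· ∉ A) : Set (Ideal S)), (Q : Set S) := by
    rw [Ideal.subset_union_prime ⊥ ⊥ fun Q hQ _ _ => (mem_F.1 (Finset.mem_filter.1 hQ).1).1.1]
    rintro ⟨Q, hQ, inf_le⟩
    obtain ⟨hQF, hQA⟩ := Finset.mem_filter.1 hQ
    have hQ' := mem_F.1 hQF
    obtain ⟨P, hP, P_le⟩ := (Ideal.IsPrime.inf_le' hQ'.1.1).1 inf_le
    obtain ⟨hPF, hPA⟩ := Finset.mem_filter.1 hP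
    exact hQA (P_le.antisymm (hQ'.2 (mem_F.1 hPF).1 P_le) ▸ hPA)
  obtain ⟨r, hr, r_notMem⟩ := Set.not_subset.1 not_subset
  refine ⟨r, fun Q hQ => ⟨fun hrQ => ?_, fun hQA => ?_⟩⟩
  · by_contra hQA
    exact r_notMem (Set.mem_biUnion (Finset.mem_filter.2 ⟨mem_F.2 hQ, hQA⟩) hrQ)
  · exact (Finset.inf_le (f := id) (Finset.mem_filter.2 ⟨mem_F.2 hQ, hQA⟩) : _ ≤ Q) hr

theorem exists_mul_mem_forall_mem_minimalPrimes {I P : Ideal S} (hP : P ∈ I.minimalPrimes) :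
    ∃ s ∉ P, ∃ y, s * y ∈ I ∧ ∀ Q ∈ I.minimalPrimes, Q ≠ P → y ∉ Q := by
  obtain ⟨s, hs⟩ := exists_forall_mem_minimalPrimes_iff I {P}ᶜ
  obtain ⟨y, hy⟩ := exists_forall_mem_minimalPrimes_iff I {P}
  have mul_mem_radical : s * y ∈ I.radical := by
    rw [← Ideal.sInf_minimalPrimes, Submodule.mem_sInf]
    intro Q hQ
    by_cases h : Q = P
    · exact Ideal.mul_mem_left _ _ ((hy Q hQ).2 h)
    · exact Ideal.mul_mem_right _ _ ((hs Q hQ).2 h)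
  obtain ⟨n, hn⟩ := mul_mem_radical
  exact ⟨s ^ n, fun h => (hs P hP).1 (hP.1.1.mem_of_pow_mem _ h) rfl, y ^ n, mul_pow s y n ▸ hn,
    fun Q hQ hQP h => hQP ((hy Q hQ).1 (hQ.1.1.mem_of_pow_mem _ h))⟩

theorem mem_of_forall_isAssociatedPrime {J : Ideal S} {v : S}
    (h : ∀ Q, IsAssociatedPrime Q (S ⧸ J) → ∃ y ∉ Q, y * v ∈ J) : v ∈ J := by
  by_contra hv
  obtain ⟨Q, hQ, colon_le⟩ := exists_le_isAssociatedPrime_of_isNoetherianRing S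
    (Ideal.Quotient.mk J v) (mt Ideal.Quotient.eq_zero_iff_mem.1 hv)
  obtain ⟨y, hy, hyv⟩ := h Q hQ
  refine hy (colon_le (Submodule.mem_colon_singleton.2 ?_))
  exact (Submodule.mem_bot S).2 (Ideal.Quotient.eq_zero_iff_mem.2 hyv)

/-- The point is that `s` does not depend on `q`: one element of `S` outside `P` clears the
denominators of all the ideals `I^[q]`. -/
theorem exists_pow_mul_mem_bracketPower {I P : Ideal S} (hP : P ∈ I.minimalPrimes) :
    ∃ s ∉ P, ∀ q, (∀ Q, IsAssociatedPrime Q (S ⧸ bracketPower I q) → Q ∈ I.minimalPrimes) →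
      ∀ s' ∉ P, ∀ v, s' * v ∈ bracketPower I q → s ^ q * v ∈ bracketPower I q := by
  obtain ⟨s, hs, y, hsy, y_notMem⟩ := exists_mul_mem_forall_mem_minimalPrimes hP
  refine ⟨s, hs, fun q unmixed s' hs' v hv => mem_of_forall_isAssociatedPrime fun Q hQ => ?_⟩
  have Q_mem := unmixed Q hQ
  obtain rfl | hQP := eq_or_ne Q P
  · exact ⟨s', hs', mul_left_comm s' (s ^ q) v ▸ Ideal.mul_mem_left _ _ hv⟩
  · refine ⟨y ^ q, fun h => y_notMem Q Q_mem hQP (Q_mem.1.1.mem_of_pow_mem _ h), ?_⟩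
    rw [← mul_assoc, ← mul_pow, mul_comm y s]
    exact Ideal.mul_mem_right _ _ (pow_mem_bracketPower hsy q)

variable {S' : Type*} [CommRing S'] [Algebra S S']

/-- Add to `c` a power of an element which lies in exactly those minimal primes of `S` that do not
contain `c`: it vanishes in the localization. -/
theorem exists_algebraMap_eq_forall_notMem_minimalPrimes (W : Submonoid S) [IsLocalization W S']
    {c : S} (hc : ∀ Q ∈ minimalPrimes S', algebraMap S S' c ∉ Q) :
    ∃ c', algebraMap S S' c' = algebraMap S S' c ∧ ∀ Q ∈ minimalPrimes S, c' ∉ Q := by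
  obtain ⟨δ, hδ⟩ := exists_forall_mem_minimalPrimes_iff (⊥ : Ideal S) {Q | c ∉ Q}
  have map_minimalPrimes : minimalPrimes S' = Ideal.under S ⁻¹' minimalPrimes S := by
    simpa only [Ideal.map_bot] using IsLocalization.minimalPrimes_map W S' (⊥ : Ideal S)
  have nilpotent : IsNilpotent (algebraMap S S' δ) := by
    rw [← mem_nilradical, nilradical, ← Ideal.sInf_minimalPrimes, Submodule.mem_sInf]
    exact fun (Q : Ideal S') hQ => (hδ (Q.under S) (map_minimalPrimes.le hQ)).2 (hc Q hQ)
  obtain ⟨n, hn⟩ := nilpotent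
  refine ⟨c + δ ^ (n + 1), by rw [map_add, map_pow, pow_succ, hn, zero_mul, add_zero],
    fun Q hQ h => ?_⟩
  have := hQ.1.1
  by_cases hcQ : c ∈ Q
  · exact (hδ Q hQ).1 (this.mem_of_pow_mem _ ((Ideal.add_mem_iff_right Q hcQ).1 h)) hcQ
  · exact hcQ ((Ideal.add_mem_iff_left Q
      (Ideal.pow_mem_of_mem Q ((hδ Q hQ).2 hcQ) _ n.succ_pos)).1 h)

theorem exists_dvd_algebraMap_forall_notMem_minimalPrimes (W : Submonoid S) [IsLocalization W S']
    {c : S'} (hc : ∀ Q ∈ minimalPrimes S', c ∉ Q) :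
    ∃ c' : S, c ∣ algebraMap S S' c' ∧ ∀ Q ∈ minimalPrimes S, c' ∉ Q := by
  obtain ⟨⟨c₀, s⟩, hc₀⟩ := IsLocalization.surj W c
  obtain ⟨c', hc', c'_notMem⟩ :=
    exists_algebraMap_eq_forall_notMem_minimalPrimes (S' := S') W (c := c₀) fun Q hQ h => by
      have := hQ.1.1
      rw [← hc₀, Ideal.mul_unit_mem_iff_mem _ (IsLocalization.map_units _ s)] at h
      exact hc Q hQ h
  exact ⟨c', ⟨_, hc'.trans hc₀.symm⟩, c'_notMem⟩

theorem tightClosure_map_algebraMap_subset {p : ℕ} [ExpChar S p] [ExpChar S' p] {I P : Ideal S}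
    [P.IsPrime] [IsLocalization.AtPrime S' P] (hP : P ∈ I.minimalPrimes)
    (unmixed : ∀ e Q, IsAssociatedPrime Q (S ⧸ bracketPower I (p ^ e)) → Q ∈ I.minimalPrimes)
    (hI : tightClosure p I ⊆ I) :
    tightClosure p (I.map (algebraMap S S')) ⊆ (I.map (algebraMap S S') : Ideal S') := by
  rintro u ⟨c, hc, e₀, he⟩
  obtain ⟨s, hs, s_clears⟩ := exists_pow_mul_mem_bracketPower hP
  obtain ⟨⟨a, s₁⟩, ha⟩ := IsLocalization.surj P.primeCompl u
  obtain ⟨c', ⟨r, hr⟩, c'_notMem⟩ :=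
    exists_dvd_algebraMap_forall_notMem_minimalPrimes P.primeCompl hc
  have mul_mem : s * a ∈ tightClosure p I := by
    refine ⟨c', c'_notMem, e₀, fun e e₀_le => ?_⟩
    have map_mem : algebraMap S S' (c' * a ^ p ^ e) ∈
        (bracketPower I (p ^ e)).map (algebraMap S S') := by
      rw [← bracketPower_map, map_mul, map_pow, hr, ← ha, mul_pow, mul_mul_mul_comm]
      exact Ideal.mul_mem_right _ _ (he e e₀_le)
    obtain ⟨s', hs', mem⟩ :=
      (IsLocalization.algebraMap_mem_map_algebraMap_iff P.primeCompl _ _ _).1 map_mem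
    rw [mul_pow, mul_left_comm]
    exact s_clears _ (unmixed e) s' hs' _ mem
  rw [SetLike.mem_coe,
    ← Ideal.mul_unit_mem_iff_mem _ (IsLocalization.map_units S' s₁), ha]
  exact (IsLocalization.algebraMap_mem_map_algebraMap_iff P.primeCompl _ _ _).2
    ⟨s, hs, hI mul_mem⟩

end PrimeAvoidance

section PowersOfParameters

theorem radical_ofList_map_pow {S : Type*} [CommSemiring S] (xs : List S) {n : ℕ} (hn : n ≠ 0) :
    (Ideal.ofList (xs.map (· ^ n))).radical = (Ideal.ofList xs).radical := by
  rw [Ideal.ofList, Ideal.ofList, ← radical_span_image_pow {r | r ∈ xs} hn]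
  congr 2
  ext
  simp

theorem minimalPrimes_ofList_map_pow {S : Type*} [CommSemiring S] (xs : List S) {n : ℕ}
    (hn : n ≠ 0) :
    (Ideal.ofList (xs.map (· ^ n))).minimalPrimes = (Ideal.ofList xs).minimalPrimes := by
  rw [← Ideal.radical_minimalPrimes, radical_ofList_map_pow xs hn, Ideal.radical_minimalPrimes]

theorem span_range_algebraMap_pow {S S' : Type*} [CommSemiring S] [CommSemiring S'] [Algebra S S']
    (xs : List S) (n : ℕ) :
    Ideal.span (Set.range fun i : Fin xs.length => algebraMap S S' xs[i] ^ n) =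
      (Ideal.ofList (xs.map (· ^ n))).map (algebraMap S S') := by
  rw [← ofList_ofFn, Ideal.map_ofList, List.map_map]
  congr 1
  apply List.ext_getElem <;> simp

end PowersOfParameters

section AtPrime

variable {S : Type*} [CommRing S]

theorem le_of_isAssociatedPrime_quotient {I Q : Ideal S}
    (hQ : IsAssociatedPrime Q (S ⧸ I)) : I ≤ Q :=
  by
  simpa only [Submodule.annihilator_top, Ideal.annihilator_quotient] using hQ.annihilator_le

theorem isAssociatedPrime_maximalIdeal_map [IsNoetherianRing S] {I Q : Ideal S} [Q.IsPrime]
    (hQ : IsAssociatedPrime Q (S ⧸ I)) :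
    IsAssociatedPrime (maximalIdeal (Localization.AtPrime Q))
      (Localization.AtPrime Q ⧸ I.map (algebraMap S (Localization.AtPrime Q))) := by
  obtain ⟨-, x, hx⟩ := isAssociatedPrime_iff.1 hQ
  obtain ⟨a, rfl⟩ := Ideal.Quotient.mk_surjective x
  have mem_Q_iff (r : S) : r ∈ Q ↔ r * a ∈ I := by
    rw [hx, Submodule.mem_colon_singleton, Submodule.mem_bot]
    exact Ideal.Quotient.eq_zero_iff_mem
  refine isAssociatedPrime_iff.2 ⟨inferInstance, Ideal.Quotient.mk _ (algebraMap S _ a),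
    (maximalIdeal.isMaximal _).eq_of_le (fun eq_top => ?_) ?_⟩
  · rw [Ideal.eq_top_iff_one, Submodule.mem_colon_singleton, one_smul, Submodule.mem_bot,
      Ideal.Quotient.eq_zero_iff_mem,
      IsLocalization.algebraMap_mem_map_algebraMap_iff Q.primeCompl] at eq_top
    obtain ⟨s, hs, hsa⟩ := eq_top
    exact hs ((mem_Q_iff s).2 hsa)
  · rw [← Localization.AtPrime.map_eq_maximalIdeal, Ideal.map_le_iff_le_comap]
    intro r hr
    rw [Ideal.mem_comap, Submodule.mem_colon_singleton, Submodule.mem_bot]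
    refine Ideal.Quotient.eq_zero_iff_mem.2 ?_
    change algebraMap S (Localization.AtPrime Q) r * algebraMap S _ a ∈ I.map _
    rw [← map_mul]
    exact Ideal.mem_map_of_mem _ ((mem_Q_iff r).1 hr)

theorem mem_minimalPrimes_of_radical_map_eq_maximalIdeal {I Q : Ideal S}
    [Q.IsPrime] (h : (I.map (algebraMap S (Localization.AtPrime Q))).radical =
      maximalIdeal (Localization.AtPrime Q)) : Q ∈ I.minimalPrimes := by
  have mem := IsLocalization.minimalPrimes_map Q.primeCompl (Localization.AtPrime Q) I
  rw [← Ideal.radical_minimalPrimes, h, Ideal.minimalPrimes_eq_subsingleton_self] at mem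
  exact Localization.AtPrime.under_maximalIdeal (I := Q) ▸ mem.le rfl

theorem expChar_localization {p : ℕ} [Fact p.Prime] [CharP S p]
    (P : Ideal S) [P.IsPrime] : ExpChar (Localization.AtPrime P) p := by
  have prime : p.Prime := Fact.out
  have : CharP (Localization.AtPrime P) p := by
    rw [CharP.charP_iff_prime_eq_zero prime, ← map_natCast (algebraMap S _), CharP.cast_eq_zero,
      map_zero]
  exact .prime prime

theorem isSystemOfParameters_algebraMap {R : Type u} [CommRing R] [IsNoetherianRing R]
    {xs : List R} {P : Ideal R} [P.IsPrime] (hxs : ∀ r ∈ xs, r ∈ P) (reg : IsWeaklyRegular R xs)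
    (hP : P ∈ (Ideal.ofList xs).minimalPrimes) :
    IsSystemOfParameters (Localization.AtPrime P)
      fun i : Fin xs.length => algebraMap R (Localization.AtPrime P) xs[i] := by
  have reg_map := reg.isRegular_of_isLocalization_of_mem (Localization.AtPrime P) P hxs
  have radical_eq := IsLocalization.AtPrime.radical_map_of_mem_minimalPrimes
    (Localization.AtPrime P) P (Ideal.ofList xs) hP
  rw [Localization.AtPrime.map_eq_maximalIdeal] at radical_eq
  refine ⟨?_, ?_⟩
  · rw [← ringKrullDim_add_length_eq_ringKrullDim_of_isRegular _ reg_map, ← Ideal.map_ofList,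
      ringKrullDim_quotient_eq_zero radical_eq, zero_add, List.length_map]
  · simpa only [pow_one, List.map_id'] using
      (congrArg Ideal.radical (span_range_algebraMap_pow xs 1)).trans (by simpa using radical_eq)

end AtPrime

section GorensteinLocalization

variable {R : Type u} [CommRing R] [IsLocalRing R] [IsNoetherianRing R]

theorem IsGorensteinLocal.localization (hR : IsGorensteinLocal R) (P : Ideal R) [P.IsPrime] :
    IsGorensteinLocal (Localization.AtPrime P) := by
  obtain ⟨n, hn⟩ := hR
  have := ModuleCat.localizedModule_isLocalizedModule (ModuleCat.of R R) P.primeCompl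
  let e : (ModuleCat.of R R).localizedModule P.primeCompl ≃ₗ[R] Localization.AtPrime P :=
    IsLocalizedModule.linearEquiv P.primeCompl
      ((ModuleCat.of R R).localizedModuleMkLinearMap P.primeCompl)
      (Algebra.linearMap R (Localization.AtPrime P))
  exact ⟨n, (ModuleCat.hasInjectiveDimensionLE_iff_of_linearEquiv
    (N := ModuleCat.of (Localization.AtPrime P) (Localization.AtPrime P))
    (e.extendScalarsOfIsLocalization P.primeCompl (Localization.AtPrime P)) n).1
      (ModuleCat.localizedModule_hasInjectiveDimensionLE n P.primeCompl (ModuleCat.of R R))⟩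

theorem IsGorensteinLocal.mem_minimalPrimes (hR : IsGorensteinLocal R) {rs : List R}
    (reg : IsWeaklyRegular R rs) {Q : Ideal R}
    (hQ : IsAssociatedPrime Q (R ⧸ Ideal.ofList rs)) : Q ∈ (Ideal.ofList rs).minimalPrimes := by
  have := hQ.isPrime
  have reg_map := reg.isRegular_of_isLocalization_of_mem (Localization.AtPrime Q) Q fun r hr =>
    le_of_isAssociatedPrime_quotient hQ (Ideal.subset_span hr)
  have assoc_map := isAssociatedPrime_maximalIdeal_map hQ
  rw [Ideal.map_ofList] at assoc_map
  obtain ⟨n, vanishing⟩ := (hR.localization Q).exists_extVanishing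
  refine mem_minimalPrimes_of_radical_map_eq_maximalIdeal ?_
  rw [Ideal.map_ofList]
  exact radical_ofList_eq_maximalIdeal reg_map
    (vanishing.of_isAssociatedPrime_quotient reg_map assoc_map)

theorem IsGorensteinLocal.isWeaklyRegular_map_pow (hR : IsGorensteinLocal R) {xs : List R}
    (hxs : ∀ r ∈ xs, r ∈ maximalIdeal R) (reg : IsWeaklyRegular R xs) {n : ℕ} (hn : n ≠ 0) :
    IsWeaklyRegular R (xs.map (· ^ n)) := by
  obtain ⟨ys, -, -, radical_eq, dim_eq⟩ := hR.exists_append xs hxs reg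
  have reg_pow := (hR.isRegular_and_extVanishing (xs := (xs ++ ys).map (· ^ n))
    (by rw [dim_eq, List.length_map]) (by rw [radical_ofList_map_pow _ hn, radical_eq])).1.1
  rw [List.map_append, isWeaklyRegular_append_iff] at reg_pow
  exact reg_pow.1

theorem IsGorensteinLocal.exists_isRegular_mem_minimalPrimes (hR : IsGorensteinLocal R)
    (P : Ideal R) [hP : P.IsPrime] :
    ∃ xs : List R, (∀ r ∈ xs, r ∈ P) ∧ IsRegular R xs ∧ P ∈ (Ideal.ofList xs).minimalPrimes := by
  obtain ⟨xs, hxs, reg, Q, hQ, P_le⟩ :=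
    exists_maximal_isRegular (le_maximalIdeal hP.ne_top) [] (by simp) (by simp)
  rw [List.nil_append] at hxs reg hQ
  have Q_mem := hR.mem_minimalPrimes reg.1 hQ
  obtain rfl : P = Q := P_le.antisymm (Q_mem.2 ⟨hP, Ideal.span_le.2 hxs⟩ P_le)
  exact ⟨xs, hxs, reg, Q_mem⟩

variable {p : ℕ} [Fact p.Prime] [CharP R p]

theorem IsGorensteinLocal.tightClosure_map_ofList_subset (hR : IsGorensteinLocal R)
    (hcl : ∀ I : Ideal R, tightClosure p I = I) {xs : List R}
    (hxs : ∀ r ∈ xs, r ∈ maximalIdeal R) (reg : IsWeaklyRegular R xs) {P : Ideal R} [P.IsPrime]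
    (hP : P ∈ (Ideal.ofList xs).minimalPrimes) :
    tightClosure p ((Ideal.ofList xs).map (algebraMap R (Localization.AtPrime P))) ⊆
      ((Ideal.ofList xs).map (algebraMap R (Localization.AtPrime P)) : Ideal _) := by
  have := expChar_localization (p := p) P
  refine tightClosure_map_algebraMap_subset hP (fun e Q hQ => ?_) (hcl _).le
  have pow_ne_zero : p ^ e ≠ 0 := pow_ne_zero e (Fact.out : p.Prime).ne_zero
  rw [bracketPower_ofList] at hQ
  rw [← minimalPrimes_ofList_map_pow xs pow_ne_zero]
  exact hR.mem_minimalPrimes (hR.isWeaklyRegular_map_pow hxs reg pow_ne_zero) hQ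

theorem IsGorensteinLocal.isFRegular (hR : IsGorensteinLocal R) (h : IsFRational p R) :
    IsFRegular p R := by
  have hcl (I : Ideal R) : tightClosure p I = I := by
    obtain ⟨d, x, hx⟩ := hR.exists_isSystemOfParameters
    exact hR.tightClosure_eq hx (fun t ht => (h d _ (hx.pow ht)).subset) I
  refine ⟨hcl, fun P hP I => ?_⟩
  obtain ⟨xs, hxs, reg, P_mem⟩ := hR.exists_isRegular_mem_minimalPrimes P
  have hxs_max : ∀ r ∈ xs, r ∈ maximalIdeal R := fun r hr => le_maximalIdeal hP.ne_top (hxs r hr)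
  refine (hR.localization P).tightClosure_eq (isSystemOfParameters_algebraMap hxs reg.1 P_mem)
    (fun t ht => ?_) I
  rw [span_range_algebraMap_pow]
  refine hR.tightClosure_map_ofList_subset hcl (List.forall_mem_map.2 fun r hr =>
      Ideal.pow_mem_of_mem _ (hxs_max r hr) t ht.pos)
    (hR.isWeaklyRegular_map_pow hxs_max reg.1 ht) ?_
  rwa [minimalPrimes_ofList_map_pow xs ht]

end GorensteinLocalization

/-! ### Morphisms out of left derived functors -/

section LeftDerived

universe w₁ w₂ w₃ w₄

variable {D : Type w₃} [Category.{w₄} D] [Abelian D]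

/-- The morphism out of the homology of a chain complex given by a cocycle. -/
noncomputable def homologyDesc (K : ChainComplex D ℕ) (n : ℕ) {A : D} (φ : K.X n ⟶ A)
    (hφ : K.d (n + 1) n ≫ φ = 0) :
    (HomologicalComplex.homologyFunctor D (ComplexShape.down ℕ) n).obj K ⟶ A :=
  K.homologyι n ≫ K.descOpcycles φ (n + 1) (by simp) hφ

theorem homologyMap_comp_homologyDesc {K L : ChainComplex D ℕ} (g : K ⟶ L) (n : ℕ) {A : D}
    (φ : L.X n ⟶ A) (hφ : L.d (n + 1) n ≫ φ = 0) :
    (HomologicalComplex.homologyFunctor D (ComplexShape.down ℕ) n).map g ≫ homologyDesc L n φ hφ =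
      homologyDesc K n (g.f n ≫ φ) (by rw [← g.comm_assoc, hφ, Limits.comp_zero]) := by
  change HomologicalComplex.homologyMap g n ≫ L.homologyι n ≫ L.descOpcycles φ (n + 1) _ hφ =
    K.homologyι n ≫ K.descOpcycles (g.f n ≫ φ) (n + 1) _ _
  rw [HomologicalComplex.homologyι_naturality_assoc,
    HomologicalComplex.opcyclesMap_comp_descOpcycles]

/-- For `n = 0` the condition on the right reads `φ = 0`, as `next 0 = 0` and `K.d 0 0 = 0`. -/
theorem homologyDesc_eq_zero_iff (K : ChainComplex D ℕ) (n : ℕ) {A : D} [Injective A]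
    (φ : K.X n ⟶ A) (hφ : K.d (n + 1) n ≫ φ = 0) :
    homologyDesc K n φ hφ = 0 ↔
      ∃ ψ : K.X ((ComplexShape.down ℕ).next n) ⟶ A, K.d n _ ≫ ψ = φ := by
  refine ⟨fun h => ?_, ?_⟩
  · have exact : (ShortComplex.mk (K.homologyι n) (K.fromOpcycles n ((ComplexShape.down ℕ).next n))
        (K.homologyι_comp_fromOpcycles _ _)).Exact :=
      ShortComplex.exact_of_f_is_kernel _ (K.homologyIsKernel n _ rfl)
    have fac : K.fromOpcycles n _ ≫ exact.descToInjective _ h =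
        K.descOpcycles φ (n + 1) (by simp) hφ := exact.comp_descToInjective _ h
    exact ⟨exact.descToInjective _ h, by
      rw [← K.p_fromOpcycles, Category.assoc, fac, K.p_descOpcycles]⟩
  · rintro ⟨ψ, rfl⟩
    exact K.homologyι_descOpcycles_eq_zero_of_boundary _ (n + 1) (by simp) ψ rfl

variable {C : Type w₁} [Category.{w₂} C] [Abelian C]

/-- The complex computing the left derived functors of `F` from a projective resolution. -/
noncomputable abbrev derivedComplex {X : C} (P : ProjectiveResolution X) (F : C ⥤ D)
    [F.Additive] : ChainComplex D ℕ :=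
  (F.mapHomologicalComplex (ComplexShape.down ℕ)).obj P.complex

variable [HasProjectiveResolutions C]

/-- The morphism out of a left derived functor given by a cocycle on a projective resolution. -/
noncomputable def leftDerivedDesc {X : C} (P : ProjectiveResolution X) (F : C ⥤ D) [F.Additive]
    (n : ℕ) {A : D} (φ : (derivedComplex P F).X n ⟶ A)
    (hφ : (derivedComplex P F).d (n + 1) n ≫ φ = 0) : (F.leftDerived n).obj X ⟶ A :=
  (P.isoLeftDerivedObj F n).hom ≫ homologyDesc (derivedComplex P F) n φ hφ

theorem leftDerived_map_comp_leftDerivedDesc {X X' : C} (f : X ⟶ X') (P : ProjectiveResolution X)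
    (P' : ProjectiveResolution X') (g : ProjectiveResolution.Hom P P' f) (F : C ⥤ D) [F.Additive]
    (n : ℕ) {A : D} (φ : (derivedComplex P' F).X n ⟶ A)
    (hφ : (derivedComplex P' F).d (n + 1) n ≫ φ = 0) :
    (F.leftDerived n).map f ≫ leftDerivedDesc P' F n φ hφ =
      leftDerivedDesc P F n (((F.mapHomologicalComplex (ComplexShape.down ℕ)).map g.hom).f n ≫ φ)
        (by rw [← HomologicalComplex.Hom.comm_assoc, hφ, Limits.comp_zero]) := by
  have g_comp_π : g.hom.f 0 ≫ P'.π.f 0 = P.π.f 0 ≫ f := by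
    rw [g.hom_f_zero_comp_π_f_zero, ChainComplex.single₀_map_f_zero]
    rfl
  unfold leftDerivedDesc
  rw [ProjectiveResolution.isoLeftDerivedObj_hom_naturality_assoc f P P' g.hom g_comp_π F n]
  exact congrArg ((P.isoLeftDerivedObj F n).hom ≫ ·) (homologyMap_comp_homologyDesc _ n φ hφ)

theorem leftDerived_app_comp_leftDerivedDesc {F G : C ⥤ D} [F.Additive] [G.Additive] (α : F ⟶ G)
    {X : C} (P : ProjectiveResolution X) (n : ℕ) {A : D} (φ : (derivedComplex P G).X n ⟶ A)
    (hφ : (derivedComplex P G).d (n + 1) n ≫ φ = 0) :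
    (NatTrans.leftDerived α n).app X ≫ leftDerivedDesc P G n φ hφ =
      leftDerivedDesc P F n
        (((NatTrans.mapHomologicalComplex α (ComplexShape.down ℕ)).app P.complex).f n ≫ φ)
        (by rw [← HomologicalComplex.Hom.comm_assoc, hφ, Limits.comp_zero]) := by
  unfold leftDerivedDesc
  rw [P.leftDerived_app_eq α n, Category.assoc, Category.assoc, Iso.inv_hom_id_assoc]
  exact congrArg ((P.isoLeftDerivedObj F n).hom ≫ ·) (homologyMap_comp_homologyDesc _ n φ hφ)

theorem leftDerivedDesc_eq_zero_iff {X : C} (P : ProjectiveResolution X) (F : C ⥤ D) [F.Additive]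
    (n : ℕ) {A : D} [Injective A] (φ : (derivedComplex P F).X n ⟶ A)
    (hφ : (derivedComplex P F).d (n + 1) n ≫ φ = 0) :
    leftDerivedDesc P F n φ hφ = 0 ↔
      ∃ ψ : (derivedComplex P F).X ((ComplexShape.down ℕ).next n) ⟶ A,
        (derivedComplex P F).d n _ ≫ ψ = φ := by
  rw [← homologyDesc_eq_zero_iff (derivedComplex P F) n φ hφ]
  exact Preadditive.IsIso.comp_left_eq_zero _ _

end LeftDerived

/-! ### Cocycles and the derived-functor `Ext` -/

section ExtClass

theorem extMk_eq_zero_iff_exists_next {C : Type*} [Category C] [Abelian C] [HasExt C]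
    {X Y : C} (P : ProjectiveResolution X) {n : ℕ} (f : P.complex.X n ⟶ Y)
    (hf : P.complex.d (n + 1) n ≫ f = 0) :
    P.extMk f (n + 1) rfl hf = 0 ↔
      ∃ g : P.complex.X ((ComplexShape.down ℕ).next n) ⟶ Y, P.complex.d n _ ≫ g = f := by
  cases n with
  | zero =>
    rw [← P.extEquivCohomologyClass.apply_eq_iff_eq, P.extEquivCohomologyClass_extMk,
      P.extEquivCohomologyClass_zero, CochainComplex.HomComplex.CohomologyClass.mk_eq_zero_iff,
      CochainComplex.HomComplex.Cocycle.toSingleMk_mem_coboundaries_iff _ _ _ _ _ 1 (by simp)]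
    have isZero : Limits.IsZero (P.cochainComplex.X 1) :=
      CochainComplex.isZero_of_isStrictlyLE _ 0 _
    refine ⟨?_, ?_⟩
    · rintro ⟨g, hg⟩
      rw [isZero.eq_zero_of_src g, Limits.comp_zero] at hg
      exact ⟨0, Limits.comp_zero.trans
        ((cancel_epi _).1 (hg.symm.trans Limits.comp_zero.symm)).symm⟩
    · rintro ⟨g, rfl⟩
      exact ⟨0, by simp⟩
  | succ m =>
    rw [P.extMk_eq_zero_iff f (m + 2) rfl hf m rfl, ChainComplex.next_nat_succ]

variable {R : Type u} [CommRing R]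

/-- Morphisms `Z ⟶ Y` as elements of the module of all such morphisms, that is, as morphisms from
`R` to it. -/
noncomputable def homElementEquiv (Z Y : ModuleCat.{u} R) :
    (Z ⟶ Y) ≃+
      (ModuleCat.of R R ⟶ ((linearYoneda R (ModuleCat.{u} R)).obj Y).obj (Opposite.op Z)) :=
  (LinearMap.ringLmapEquivSelf R R (Z ⟶ Y)).symm.toAddEquiv.trans
    (ModuleCat.homAddEquiv (M := ModuleCat.of R R)
      (N := ((linearYoneda R (ModuleCat.{u} R)).obj Y).obj (Opposite.op Z))).symm

theorem homElementEquiv_comp_map {Z Z' Y : ModuleCat.{u} R} (f : Z ⟶ Y) (h : Z' ⟶ Z) :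
    homElementEquiv Z Y f ≫ ((linearYoneda R (ModuleCat.{u} R)).obj Y).map h.op =
      homElementEquiv Z' Y (h ≫ f) := by
  refine ModuleCat.hom_ext (LinearMap.ext_ring ?_)
  change h ≫ ((1 : R) • f) = (1 : R) • (h ≫ f)
  rw [one_smul, one_smul]

theorem homElementEquiv_comp_app {Z Y Y' : ModuleCat.{u} R} (f : Z ⟶ Y) (g : Y ⟶ Y') :
    homElementEquiv Z Y f ≫ ((linearYoneda R (ModuleCat.{u} R)).map g).app (Opposite.op Z) =
      homElementEquiv Z Y' (f ≫ g) := by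
  refine ModuleCat.hom_ext (LinearMap.ext_ring ?_)
  change ((1 : R) • f) ≫ g = (1 : R) • (f ≫ g)
  rw [one_smul, one_smul]

/-- The functor `Hom(-, Y)`, with values in the opposite category: its left derived functors are by
definition the `Ext` of Mathlib that enters local cohomology. -/
noncomputable abbrev homOp (Y : ModuleCat.{u} R) : ModuleCat.{u} R ⥤ (ModuleCat.{u} R)ᵒᵖ :=
  ((linearYoneda R (ModuleCat.{u} R)).obj Y).rightOp

theorem d_comp_op_homElementEquiv {X Y : ModuleCat.{u} R} (P : ProjectiveResolution X) {m n : ℕ}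
    (f : P.complex.X n ⟶ Y) :
    (derivedComplex P (homOp Y)).d m n ≫ (homElementEquiv _ Y f).op =
      (homElementEquiv _ Y (P.complex.d m n ≫ f)).op :=
  congrArg Quiver.Hom.op (homElementEquiv_comp_map f (P.complex.d m n))

theorem d_comp_op_homElementEquiv_eq_zero {X Y : ModuleCat.{u} R} (P : ProjectiveResolution X)
    {n : ℕ} {f : P.complex.X n ⟶ Y} (hf : P.complex.d (n + 1) n ≫ f = 0) :
    (derivedComplex P (homOp Y)).d (n + 1) n ≫ (homElementEquiv _ Y f).op = 0 := by
  rw [d_comp_op_homElementEquiv, hf, map_zero]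
  rfl

/-- The element of the derived-functor `Ext` given by a cocycle on a projective resolution; the
counterpart of `ProjectiveResolution.extMk`. -/
noncomputable def extClass {X Y : ModuleCat.{u} R} (P : ProjectiveResolution X) {n : ℕ}
    (f : P.complex.X n ⟶ Y) (hf : P.complex.d (n + 1) n ≫ f = 0) :
    ((_root_.Ext R (ModuleCat.{u} R) n).obj (Opposite.op X)).obj Y :=
  (leftDerivedDesc P (homOp Y) n (homElementEquiv _ Y f).op
    (d_comp_op_homElementEquiv_eq_zero P hf)).unop.hom (1 : R)

instance injective_op_self : Injective (Opposite.op (ModuleCat.of R R)) := by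
  have : Projective (ModuleCat.of R R) := (IsProjective.iff_projective R).1 inferInstance
  infer_instance

theorem extClass_eq_zero_iff {X Y : ModuleCat.{u} R} (P : ProjectiveResolution X) {n : ℕ}
    (f : P.complex.X n ⟶ Y) (hf : P.complex.d (n + 1) n ≫ f = 0) :
    extClass P f hf = 0 ↔ P.extMk f (n + 1) rfl hf = 0 := by
  have desc_eq_zero_iff : extClass P f hf = 0 ↔
      leftDerivedDesc P (homOp Y) n (homElementEquiv _ Y f).op
        (d_comp_op_homElementEquiv_eq_zero P hf) = 0 :=
    ⟨fun h => Quiver.Hom.unop_inj (ModuleCat.hom_ext (LinearMap.ext_ring h)),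
      fun h => by rw [extClass, h]; rfl⟩
  rw [extMk_eq_zero_iff_exists_next]
  refine desc_eq_zero_iff.trans ((leftDerivedDesc_eq_zero_iff P (homOp Y) n _ _).trans ⟨?_, ?_⟩)
  · rintro ⟨ψ, hψ⟩
    obtain ⟨g, hg⟩ := (homElementEquiv (P.complex.X _) Y).surjective ψ.unop
    refine ⟨g, (homElementEquiv _ Y).injective (Quiver.Hom.op_inj ?_)⟩
    rw [← d_comp_op_homElementEquiv, ← hψ, hg]
    rfl
  · rintro ⟨g, rfl⟩
    exact ⟨(homElementEquiv _ Y g).op, d_comp_op_homElementEquiv P g⟩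

theorem map_extClass {X Y Y' : ModuleCat.{u} R} (P : ProjectiveResolution X) {n : ℕ}
    (f : P.complex.X n ⟶ Y) (hf : P.complex.d (n + 1) n ≫ f = 0) (g : Y ⟶ Y') :
    (((_root_.Ext R (ModuleCat.{u} R) n).obj (Opposite.op X)).map g).hom (extClass P f hf) =
      extClass P (f ≫ g) (by rw [reassoc_of% hf, Limits.zero_comp]) := by
  have app_comp : ((NatTrans.mapHomologicalComplex
      (NatTrans.rightOp ((linearYoneda R (ModuleCat.{u} R)).map g))
      (ComplexShape.down ℕ)).app P.complex).f n ≫ (homElementEquiv _ Y f).op =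
      (homElementEquiv _ Y' (f ≫ g)).op :=
    congrArg Quiver.Hom.op (homElementEquiv_comp_app f g)
  have app_comp_desc := leftDerived_app_comp_leftDerivedDesc
    (NatTrans.rightOp ((linearYoneda R (ModuleCat.{u} R)).map g)) P n (homElementEquiv _ Y f).op
    (d_comp_op_homElementEquiv_eq_zero P hf)
  simp only [app_comp] at app_comp_desc
  exact congrArg (fun φ : ((homOp Y').leftDerived n).obj X ⟶ Opposite.op (ModuleCat.of R R) =>
    φ.unop.hom (1 : R)) app_comp_desc

theorem map_op_extClass {X X' Y : ModuleCat.{u} R} (h : X ⟶ X') (P : ProjectiveResolution X)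
    (P' : ProjectiveResolution X') (φ : ProjectiveResolution.Hom P P' h) {n : ℕ}
    (f : P'.complex.X n ⟶ Y) (hf : P'.complex.d (n + 1) n ≫ f = 0) :
    (((_root_.Ext R (ModuleCat.{u} R) n).map h.op).app Y).hom (extClass P' f hf) =
      extClass P (φ.hom.f n ≫ f) (by rw [← φ.hom.comm_assoc, hf, Limits.comp_zero]) := by
  have map_comp : (((homOp Y).mapHomologicalComplex (ComplexShape.down ℕ)).map φ.hom).f n ≫
      (homElementEquiv _ Y f).op = (homElementEquiv _ Y (φ.hom.f n ≫ f)).op :=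
    congrArg Quiver.Hom.op (homElementEquiv_comp_map f (φ.hom.f n))
  have map_comp_desc := leftDerived_map_comp_leftDerivedDesc h P P' φ (homOp Y) n
    (homElementEquiv _ Y f).op (d_comp_op_homElementEquiv_eq_zero P' hf)
  simp only [map_comp] at map_comp_desc
  exact congrArg (fun ψ : ((homOp Y).leftDerived n).obj X ⟶ Opposite.op (ModuleCat.of R R) =>
    ψ.unop.hom (1 : R)) map_comp_desc

end ExtClass

/-! ### Local cohomology classes -/

section LocalCohomology

variable {R : Type u} [CommRing R]

theorem map_op_extClass_eq_zero_iff {X X' Y : ModuleCat.{u} R} (h : X ⟶ X')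
    (P : ProjectiveResolution X) (P' : ProjectiveResolution X') {n : ℕ}
    (f : P'.complex.X n ⟶ Y) (hf : P'.complex.d (n + 1) n ≫ f = 0) :
    (((_root_.Ext R (ModuleCat.{u} R) n).map h.op).app Y).hom (extClass P' f hf) = 0 ↔
      (Ext.mk₀ h).comp (P'.extMk f (n + 1) rfl hf) (zero_add n) = 0 := by
  let φ : ProjectiveResolution.Hom P P' h :=
    { hom := ProjectiveResolution.lift h P P'
      hom_f_zero_comp_π_f_zero := by
        rw [← HomologicalComplex.comp_f, ProjectiveResolution.lift_commutes,
          HomologicalComplex.comp_f] }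
  rw [map_op_extClass h P P' φ, extClass_eq_zero_iff, ProjectiveResolution.mk₀_comp_extMk _ _ _ _ φ]

/-- The projection `R ⧸ J ^ n ⟶ R ⧸ J ^ N` for `N ≤ n`. -/
def powTransition (J : Ideal R) {N n : ℕ} (h : N ≤ n) :
    ModuleCat.of R (R ⧸ J ^ n) ⟶ ModuleCat.of R (R ⧸ J ^ N) :=
  ModuleCat.ofHom (Submodule.factor (Ideal.pow_le_pow_right h))

theorem colimit_ι_app_eq_zero_iff {K : Type} [SmallCategory K] [IsFiltered K]
    {A : Type*} [Category A] (D : K ⥤ A ⥤ ModuleCat.{u} R) [Limits.HasColimit D] (k : K) (Q : A)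
    (x : (D.obj k).obj Q) : ((Limits.colimit.ι D k).app Q).hom x = 0 ↔
      ∃ (k' : K) (f : k ⟶ k'), ((D.map f).app Q).hom x = 0 := by
  refine ⟨fun h => ?_, ?_⟩
  · have : Limits.PreservesFilteredColimitsOfSize.{0, 0} (forget (ModuleCat.{u} R)) :=
      Limits.preservesSmallestFilteredColimits_of_preservesFilteredColimits.{u, u} _
    have isColimit := Limits.isColimitOfPreserves ((evaluation A (ModuleCat.{u} R)).obj Q)
      (Limits.colimit.isColimit D)
    obtain ⟨k', f, g, hfg⟩ := Limits.Concrete.isColimit_exists_of_rep_eq _ isColimit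
      (i := k) (j := k) x 0 (h.trans (map_zero ((Limits.colimit.ι D k).app Q).hom).symm)
    exact ⟨k', f, hfg.trans (map_zero ((D.map g).app Q).hom)⟩
  · rintro ⟨k', f, hf⟩
    rw [← Limits.colimit.w D f, NatTrans.comp_app, ModuleCat.hom_comp, LinearMap.comp_apply, hf,
      map_zero]

/-- The natural map from `Ext` of `R ⧸ J ^ N` to local cohomology with support in `J`. -/
noncomputable def extToLocalCohomology (J : Ideal R) (d N : ℕ) :
    (_root_.Ext R (ModuleCat.{u} R) d).obj (Opposite.op (ModuleCat.of R (R ⧸ J ^ N))) ⟶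
      localCohomology J d :=
  have := localCohomology.hasColimitDiagram (localCohomology.idealPowersDiagram J) d
  Limits.colimit.ι (localCohomology.diagram (localCohomology.idealPowersDiagram J) d)
    (Opposite.op (Opposite.op N))

theorem extToLocalCohomology_app_eq_zero_iff (J : Ideal R) (d N : ℕ) (Q : ModuleCat.{u} R)
    (x : ((_root_.Ext R (ModuleCat.{u} R) d).obj
      (Opposite.op (ModuleCat.of R (R ⧸ J ^ N)))).obj Q) :
    ((extToLocalCohomology J d N).app Q).hom x = 0 ↔ ∃ (n : ℕ) (h : N ≤ n),
      (((_root_.Ext R (ModuleCat.{u} R) d).map (powTransition J h).op).app Q).hom x = 0 := by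
  have := localCohomology.hasColimitDiagram (localCohomology.idealPowersDiagram J) d
  let D := localCohomology.diagram (localCohomology.idealPowersDiagram J) d
  have ι_app_eq_zero_iff := colimit_ι_app_eq_zero_iff D (Opposite.op (Opposite.op N)) Q x
  refine ι_app_eq_zero_iff.trans ⟨?_, ?_⟩
  · rintro ⟨k, f, hf⟩
    exact ⟨k.unop.unop, f.unop.unop.down.down, hf⟩
  · rintro ⟨n, h, hn⟩
    let f : Opposite.op (Opposite.op N) ⟶ Opposite.op (Opposite.op n) := (homOfLE h).op.op
    exact ⟨_, f, hn⟩

theorem exists_localCohomology_map_eq_zero_iff (J : Ideal R) (d N : ℕ) {M : ModuleCat.{u} R}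
    (e : Ext (ModuleCat.of R (R ⧸ J ^ N)) M d) :
    ∃ ξ : (localCohomology J d).obj M, ∀ (Q : ModuleCat.{u} R) (φ : M ⟶ Q),
      ((localCohomology J d).map φ).hom ξ = 0 ↔ ∃ (n : ℕ) (h : N ≤ n),
        (Ext.mk₀ (powTransition J h)).comp (e.comp (Ext.mk₀ φ) (add_zero d)) (zero_add d) = 0 := by
  let P (n : ℕ) := projectiveResolution (ModuleCat.of R (R ⧸ J ^ n))
  obtain ⟨f, hf, rfl⟩ := (P N).extMk_surjective e (d + 1) rfl
  refine ⟨((extToLocalCohomology J d N).app M).hom (extClass (P N) f hf), fun Q φ => ?_⟩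
  have map_class := congrArg (fun z => z.hom (extClass (P N) f hf))
    ((extToLocalCohomology J d N).naturality φ)
  simp only [ModuleCat.hom_comp, LinearMap.comp_apply, map_extClass] at map_class
  simp only [← map_class, extToLocalCohomology_app_eq_zero_iff, (P N).extMk_comp_mk₀,
    map_op_extClass_eq_zero_iff _ (P _) (P N)]

end LocalCohomology

/-! ### `F`-injective Gorenstein rings are `F`-pure -/

section Annihilator

variable {R : Type u} [CommRing R]

theorem exists_ext_smul_eq_zero_iff (M : ModuleCat.{u} R) (rs : List R)
    (reg : IsWeaklyRegular M rs) :
    ∃ η : Ext (ModuleCat.of R (M ⧸ Ideal.ofList rs • (⊤ : Submodule R M))) M rs.length,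
      ∀ r : R, r • η = 0 ↔ ∀ z : M ⧸ Ideal.ofList rs • (⊤ : Submodule R M), r • z = 0 := by
  let Z := ModuleCat.of R (M ⧸ Ideal.ofList rs • (⊤ : Submodule R M))
  have smul_eq_zero (r : R) (hr : r ∈ rs) (z : Z) : r • z = 0 := by
    obtain ⟨m, rfl⟩ := Submodule.mkQ_surjective _ z
    rw [← map_smul]
    exact (Submodule.Quotient.mk_eq_zero _).2
      (Submodule.smul_mem_smul (Ideal.subset_span hr) trivial)
  obtain ⟨η, hη⟩ := exists_ext_comp_bijective M rs reg
  refine ⟨η, fun r => ⟨fun hr z => ?_, fun hr => smul_ext_eq_zero hr η⟩⟩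
  have smul_id_eq_zero : r • 𝟙 Z = 0 := (hη Z smul_eq_zero).1 <| by
    simp only [Ext.mk₀_smul, Ext.smul_comp, Ext.mk₀_id_comp, hr, Ext.mk₀_zero, Ext.zero_comp]
  exact congrArg (fun φ : Z ⟶ Z => φ.hom z) smul_id_eq_zero

theorem eq_zero_of_mk₀_comp_eq_zero {M : ModuleCat.{u} R} {rs : List R}
    (reg : IsWeaklyRegular M rs) {X Z : ModuleCat.{u} R} (hX : ∀ r ∈ rs, ∀ n : X, r • n = 0)
    (π : X ⟶ Z) (hπ : Function.Surjective π.hom) {d : ℕ} (hd : d ≤ rs.length) (e : Ext Z M d)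
    (he : (Ext.mk₀ π).comp e (zero_add d) = 0) : e = 0 := by
  cases d with
  | zero =>
    have : Epi π := (ModuleCat.epi_iff_surjective π).2 hπ
    exact Ext.precomp_mk₀_injective_of_epi M π (he.trans (map_zero _).symm)
  | succ d =>
    let S : ShortComplex (ModuleCat.{u} R) :=
      ShortComplex.mk (ModuleCat.ofHom (LinearMap.ker π.hom).subtype) π
        (ModuleCat.hom_ext (LinearMap.comp_ker_subtype π.hom))
    have exact : S.ShortExact := ModuleCat.shortComplex_shortExact S
      (LinearMap.exact_subtype_ker_map π.hom) Subtype.val_injective hπ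
    obtain ⟨y, rfl⟩ := Ext.contravariant_sequence_exact₃ exact M e he (add_comm 1 d)
    have : Subsingleton (Ext S.X₁ M d) := subsingleton_ext_of_isWeaklyRegular reg
      (fun r hr (n : LinearMap.ker π.hom) => Subtype.ext (hX r hr n)) (Nat.lt_of_succ_le hd)
    rw [Subsingleton.elim y 0, Ext.comp_zero]

/-- A `Q`-regular sequence of length `d` in `J ^ n` makes `Ext^d(Z, Q) → Ext^d(R ⧸ J ^ n, Q)`
injective, so that a class which is nonzero at the start survives in the direct limit. -/
theorem exists_localCohomology_map_eq_zero_and_comp_eq_zero {J : Ideal R} {N d : ℕ}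
    {Z M : ModuleCat.{u} R} (π : ModuleCat.of R (R ⧸ J ^ N) ⟶ Z)
    (hπ : Function.Surjective π.hom) (e : Ext Z M d) :
    ∃ ξ : (localCohomology J d).obj M, ∀ (Q : ModuleCat.{u} R) (φ : M ⟶ Q),
      (e.comp (Ext.mk₀ φ) (add_zero d) = 0 → ((localCohomology J d).map φ).hom ξ = 0) ∧
      ((∀ n, ∃ rs : List R, d ≤ rs.length ∧ IsWeaklyRegular Q rs ∧ ∀ r ∈ rs, r ∈ J ^ n) →
        ((localCohomology J d).map φ).hom ξ = 0 → e.comp (Ext.mk₀ φ) (add_zero d) = 0) := by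
  obtain ⟨ξ, hξ⟩ :=
    exists_localCohomology_map_eq_zero_iff J d N ((Ext.mk₀ π).comp e (zero_add d))
  refine ⟨ξ, fun Q φ => ⟨fun h => (hξ Q φ).2 ⟨N, le_rfl, ?_⟩, fun reg h => ?_⟩⟩
  · rw [Ext.comp_assoc _ _ _ (zero_add d) (add_zero d) (by simp), h, Ext.comp_zero, Ext.comp_zero]
  · obtain ⟨n, hNn, hn⟩ := (hξ Q φ).1 h
    obtain ⟨rs, hd, reg, hrs⟩ := reg n
    rw [Ext.comp_assoc _ _ _ (zero_add d) (add_zero d) (by simp), Ext.mk₀_comp_mk₀_assoc] at hn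
    exact eq_zero_of_mk₀_comp_eq_zero reg (fun r hr => smul_quotient_eq_zero (hrs r hr))
      (powTransition J hNn ≫ π)
      (hπ.comp (Submodule.factor_surjective (Ideal.pow_le_pow_right hNn))) hd _ hn

/-- The morphism `R ⟶ Q` that sends `1` to `q`. -/
def spanMap {Q : ModuleCat.{u} R} (q : Q) : ModuleCat.of R R ⟶ Q :=
  ModuleCat.ofHom (LinearMap.toSpanSingleton R Q q)

theorem spanMap_comp {Q Q' : ModuleCat.{u} R} (q : Q) (f : Q ⟶ Q') :
    spanMap q ≫ f = spanMap (f.hom q) :=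
  ModuleCat.hom_ext (LinearMap.comp_toSpanSingleton f.hom q)

theorem spanMap_self (r : R) : spanMap (Q := ModuleCat.of R R) r = r • 𝟙 (ModuleCat.of R R) :=
  ModuleCat.hom_ext (LinearMap.ext_ring (mul_comm 1 r))

theorem comp_mk₀_spanMap_eq_zero {X : ModuleCat.{u} R} {d : ℕ} {I : Ideal R}
    (e : Ext X (ModuleCat.of R R) d) (he : ∀ r ∈ I, r • e = 0) {Q : ModuleCat.{u} R} {q : Q}
    (hq : q ∈ I • (⊤ : Submodule R Q)) : e.comp (Ext.mk₀ (spanMap q)) (add_zero d) = 0 := by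
  induction hq using Submodule.smul_induction_on' with
  | smul r hr q _ =>
    have spanMap_smul : spanMap (r • q) = r • spanMap q :=
      ModuleCat.hom_ext (LinearMap.toSpanSingleton_smul r q)
    rw [spanMap_smul, Ext.mk₀_smul, Ext.comp_smul, ← Ext.smul_comp, he r hr, Ext.zero_comp]
  | add q _ q' _ hq hq' =>
    have spanMap_add : spanMap (q + q') = spanMap q + spanMap q' :=
      ModuleCat.hom_ext (LinearMap.toSpanSingleton_add q q')
    rw [spanMap_add, Ext.mk₀_add, Ext.comp_add, hq, hq', add_zero]

variable [IsLocalRing R] [IsNoetherianRing R]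

/-- The image of `ξ` under the map induced by `spanMap q` plays the role of `q ⊗ ξ`; for `Q = R`
it is `q • ξ`, so `ξ` has annihilator `(x)`. -/
theorem IsGorensteinLocal.exists_localCohomology_annihilator (hR : IsGorensteinLocal R) {d : ℕ}
    {x : Fin d → R} (hx : IsSystemOfParameters R x) :
    ∃ ξ : (localCohomology (maximalIdeal R) d).obj (ModuleCat.of R R),
      (∀ (Q : ModuleCat.{u} R) (q : Q), q ∈ Ideal.span (Set.range x) • (⊤ : Submodule R Q) →
        ((localCohomology (maximalIdeal R) d).map (spanMap q)).hom ξ = 0) ∧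
      ∀ r : R, ((localCohomology (maximalIdeal R) d).map
        (spanMap (Q := ModuleCat.of R R) r)).hom ξ = 0 → r ∈ Ideal.span (Set.range x) := by
  let I := Ideal.ofList (List.ofFn x)
  have reg := (hR.isRegular_of_isSystemOfParameters hx).1.toIsWeaklyRegular
  have exists_ext := exists_ext_smul_eq_zero_iff (ModuleCat.of R R) _ reg
  rw [List.length_ofFn] at exists_ext
  obtain ⟨η, smul_η_eq_zero_iff⟩ := exists_ext
  have smul_η_eq_zero_iff (r : R) : r • η = 0 ↔ r ∈ I := by
    rw [smul_η_eq_zero_iff, ← Module.mem_annihilator]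
    change r ∈ Module.annihilator R (R ⧸ I * ⊤) ↔ r ∈ I
    rw [Ideal.mul_top, Ideal.annihilator_quotient]
  obtain ⟨N, hN⟩ : ∃ N, maximalIdeal R ^ N ≤ I * ⊤ := by
    rw [Ideal.mul_top, ← hx.2, ← ofList_ofFn]
    exact I.exists_radical_pow_le_of_fg (IsNoetherian.noetherian _)
  obtain ⟨ξ, hξ⟩ := exists_localCohomology_map_eq_zero_and_comp_eq_zero
    (ModuleCat.ofHom (Submodule.factor hN)) (Submodule.factor_surjective hN) η
  rw [← ofList_ofFn]
  refine ⟨ξ, fun Q q hq => (hξ Q _).1 ?_, fun r hr => ?_⟩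
  · exact comp_mk₀_spanMap_eq_zero η (fun r hr => (smul_η_eq_zero_iff r).2 hr) hq
  · have comp_eq_zero := (hξ _ _).2 (fun n => ?_) hr
    · rwa [spanMap_self, Ext.mk₀_smul, Ext.comp_smul, Ext.comp_mk₀_id, smul_η_eq_zero_iff]
        at comp_eq_zero
    · have hx_pow := hx.pow n.succ_ne_zero
      refine ⟨_, List.length_ofFn.ge,
        (hR.isRegular_of_isSystemOfParameters hx_pow).1.toIsWeaklyRegular, fun r hr => ?_⟩
      obtain ⟨i, rfl⟩ := List.mem_ofFn.1 hr
      exact Ideal.pow_le_pow_right n.le_succ (Ideal.pow_mem_pow (hx.mem_maximalIdeal i) _)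

end Annihilator

section FPure

variable {R : Type u} [CommRing R]

theorem exists_finite_tmul_eq_zero {M P : Type*} [AddCommGroup M] [Module R M] [AddCommGroup P]
    [Module R P] {m : M} {y : P} (h : m ⊗ₜ[R] y = 0) :
    ∃ (M' : Submodule R M) (hm : m ∈ M'), Module.Finite R M' ∧ (⟨m, hm⟩ : M') ⊗ₜ[R] y = 0 := by
  have hm : m ∈ Submodule.span R {m} := Submodule.mem_span_singleton_self m
  obtain ⟨M', hle, fg, tmul_eq_zero⟩ := TensorProduct.eq_zero_of_fg_of_subtype_eq_zero
    (Submodule.fg_span_singleton m) (t := (⟨m, hm⟩ : Submodule.span R {m}) ⊗ₜ[R] y)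
    ((LinearMap.rTensor_tmul ..).trans h)
  exact ⟨M', hle hm, Module.Finite.iff_fg.2 fg, (LinearMap.rTensor_tmul ..).symm.trans tmul_eq_zero⟩

theorem apply_mem_smul_top_of_tmul_eq_zero {M P : Type*} [AddCommGroup M] [Module R M]
    [AddCommGroup P] [Module R P] (f : R →ₗ[R] P) {I : Ideal R} (g : M →ₗ[R] R ⧸ I) {m : M} {a : R}
    (ha : Ideal.Quotient.mk I a = g m) (h : m ⊗ₜ[R] f 1 = 0) : f a ∈ I • (⊤ : Submodule R P) := by
  have tmul_eq_zero := congrArg (g.rTensor P) h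
  rw [LinearMap.rTensor_tmul, map_zero, ← ha] at tmul_eq_zero
  rw [← mul_one a, ← smul_eq_mul, map_smul, ← Submodule.Quotient.mk_eq_zero,
    ← TensorProduct.quotTensorEquivQuotSMul_mk_tmul, tmul_eq_zero, map_zero]

theorem lTensor_injective_of_forall_finite {P : Type*} [AddCommGroup P] [Module R P]
    (f : R →ₗ[R] P)
    (h : ∀ (M : Type u) [AddCommGroup M] [Module R M] [Module.Finite R M] (m : M), m ≠ 0 →
      ∃ I : Ideal R, (∀ a, f a ∈ I • (⊤ : Submodule R P) → a ∈ I) ∧ ∃ g : M →ₗ[R] R ⧸ I, g m ≠ 0)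
    (M : Type u) [AddCommGroup M] [Module R M] : Function.Injective (f.lTensor M) := by
  rw [injective_iff_map_eq_zero]
  intro z hz
  obtain ⟨m, rfl⟩ := (TensorProduct.rid R M).symm.surjective z
  rw [TensorProduct.rid_symm_apply, LinearMap.lTensor_tmul] at hz
  obtain ⟨M', hm, _, tmul_eq_zero⟩ := exists_finite_tmul_eq_zero hz
  by_contra ne_zero
  have m_ne : (⟨m, hm⟩ : M') ≠ 0 := fun h => ne_zero <| by
    rw [show m = 0 from congrArg Subtype.val h, map_zero]
  obtain ⟨I, closed, g, hg⟩ := h M' ⟨m, hm⟩ m_ne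
  obtain ⟨a, ha⟩ := Ideal.Quotient.mk_surjective (g ⟨m, hm⟩)
  have a_mem := closed a (apply_mem_smul_top_of_tmul_eq_zero f g ha tmul_eq_zero)
  exact hg (ha.symm.trans (Ideal.Quotient.eq_zero_iff_mem.2 a_mem))

variable [IsLocalRing R] [IsNoetherianRing R] {p : ℕ} [Fact p.Prime] [CharP R p]

theorem IsGorensteinLocal.mem_of_frobeniusLinear_mem (hR : IsGorensteinLocal R)
    (hF : IsFInjective p R) {d : ℕ} {x : Fin d → R} (hx : IsSystemOfParameters R x) {a : R}
    (ha : frobeniusLinear p R a ∈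
      Ideal.span (Set.range x) • (⊤ : Submodule R (FrobeniusPushforward p R))) :
    a ∈ Ideal.span (Set.range x) := by
  obtain ⟨ξ, map_eq_zero, mem_of_map_eq_zero⟩ := hR.exists_localCohomology_annihilator hx
  refine mem_of_map_eq_zero a (hF d ?_)
  rw [map_zero, ← LinearMap.comp_apply, ← ModuleCat.hom_comp, ← Functor.map_comp, spanMap_comp]
  exact map_eq_zero (ModuleCat.of R (FrobeniusPushforward p R)) _ ha

theorem IsGorensteinLocal.isFPure (hR : IsGorensteinLocal R) (hF : IsFInjective p R) :
    IsFPure p R := by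
  obtain ⟨d, x, hx⟩ := hR.exists_isSystemOfParameters
  refine lTensor_injective_of_forall_finite _ fun M _ _ _ m hm => ?_
  obtain ⟨t, ht, detect⟩ := hR.exists_linearMap_quotient_pow hx (Set.Ioi_infinite 0) hm
  exact ⟨_, fun a => hR.mem_of_frobeniusLinear_mem hF (hx.pow (Nat.ne_of_gt ht)), detect⟩

end FPure

end FSing

theorem mainTheorem7_general (R : Type u) [CommRing R] [IsLocalRing R] [IsNoetherianRing R]
    (hR : FSing.IsGorensteinLocal R) :
    (∀ c : FSing.ClosureOperation R, c.Functorial → c.Residual →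
      ∀ (d : ℕ) (x : Fin d → R), FSing.IsSystemOfParameters R x →
        {t : ℕ | c.cl R (Ideal.span (Set.range fun i => x i ^ t)) =
          Ideal.span (Set.range fun i => x i ^ t)}.Infinite →
        (∀ I : Ideal R, c.cl R I = I) ∧
        ∀ (M : Type u) [AddCommGroup M] [Module R M] [Module.Finite R M],
          c.cl M (⊥ : Submodule R M) = ⊥) ∧
    (∀ (p : ℕ) [Fact p.Prime] [CharP R p], FSing.IsFRational p R → FSing.IsFRegular p R) ∧
    (∀ (K : Type v) [Field K] [CharZero K] [Algebra K R],
      FSing.IsFRationalZero K R → FSing.IsFRegularZero K R) ∧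
    (∀ (p : ℕ) [Fact p.Prime] [CharP R p], FSing.IsFInjective p R → FSing.IsFPure p R) :=
  ⟨fun _ functorial residual _ _ hx hT =>
      ⟨fun I => (residual.cl_eq_self_iff I).2 (hR.cl_bot functorial residual hx hT (R ⧸ I)),
        fun M _ _ _ => hR.cl_bot functorial residual hx hT M⟩,
    fun _ _ _ hF => hR.isFRegular hF,
    fun _ _ _ _ hF => hR.isFRegularZero hF,
    fun _ _ _ hF => hR.isFPure hF⟩

theorem mainTheorem7 (R : Type u) [CommRing R] [IsLocalRing R] [IsNoetherianRing R]
    [IsAdicComplete (IsLocalRing.maximalIdeal R) R] (hR : FSing.IsGorensteinLocal R) :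
    -- functorial residual closure operations closing the powers of a system of parameters
    (∀ c : FSing.ClosureOperation R, c.Functorial → c.Residual →
      ∀ (d : ℕ) (x : Fin d → R), FSing.IsSystemOfParameters R x →
        {t : ℕ | c.cl R (Ideal.span (Set.range fun i => x i ^ t)) =
          Ideal.span (Set.range fun i => x i ^ t)}.Infinite →
        (∀ I : Ideal R, c.cl R I = I) ∧
        ∀ (M : Type u) [AddCommGroup M] [Module R M] [Module.Finite R M],
          c.cl M (⊥ : Submodule R M) = ⊥) ∧
    -- equicharacteristic and `F`-rational implies `F`-regular: characteristic `p`
    (∀ (p : ℕ) [Fact p.Prime] [CharP R p], FSing.IsFRational p R → FSing.IsFRegular p R) ∧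
    -- the same in equal characteristic zero
    (∀ (K : Type v) [Field K] [CharZero K] [Algebra K R],
      FSing.IsFRationalZero K R → FSing.IsFRegularZero K R) ∧
    -- `F`-injective implies `F`-pure
    (∀ (p : ℕ) [Fact p.Prime] [CharP R p], FSing.IsFInjective p R → FSing.IsFPure p R) :=
  mainTheorem7_general R hR
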